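/- Let $X$ be a (real or complex) Banach space, let $(T(t))_{t\ge 0}$ be a $C_0$-semigroup on $X$ with generator $A:\operatorname{dom}(A)\subseteq X\to X$, and let $V$ be a Banach space that embeds continuously into $X$. Let $B:\operatorname{dom}(B)\subseteq X\to X$ be a linear operator with $\operatorname{dom}(A)\subseteq\operatorname{dom}(B)$ whose restriction to $\operatorname{dom}(A)$, equipped with the graph norm of $A$, is bounded into $X$. Suppose that there are constants $C\ge 1$, $\alpha>0$, $\beta\in[0,1)$, $q\in(0,1)$ and $t_0>0$ such that: (S1) $T(t)X\subseteq V$ and $\|T(t)\|_{X\to V}\le C t^{-\alpha}$ for all $t\in(0,1]$; (S2) $\int_0^{t_0}\|BT(s)x\|_X\,ds\le q\|x\|_X$ for all $x\in\operatorname{dom}(A)$; (S3) $\|T(t)\|_{V\to V}\le C$ for all $t\in(0,1]$; moreover, $BT(t)x\in V$ and $\|BT(t)x\|_V\le C t^{-\beta}\|x\|_V$ whenever $x\in V$ and $t\in(0,1]$ are such that $T(t)x\in\operatorname{dom}(B)$. Suppose further that $V$ is separable or that the closed unit ball of $V$ is closed in $X$. Finally, suppose that $(T(t))_{t\ge 0}$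 is immediately differentiable, i.e. for every $x\in X$ the orbit $t\mapsto T(t)x$ is differentiable on $(0,\infty)$. Then $A+B$, with domain $\operatorname{dom}(A)$, generates a $C_0$-semigroup $(S(t))_{t\ge 0}$ on $X$, and there exists a constant $\widetilde C>0$ such that $$S(t)X\subseteq V\quad\text{and}\quad \|S(t)\|_{X\to V}\le\widetilde C t^{-\alpha}\qquad\text{for all } t\in(0,1].$$ -/

import Mathlib

open Set Filter Topology

noncomputable section

namespace UltraPerturb

variable {𝕜 X V Y : Type*} [RCLike 𝕜]
  [NormedAddCommGroup X] [NormedSpace 𝕜 X]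
  [NormedAddCommGroup V] [NormedSpace 𝕜 V]
  [NormedAddCommGroup Y] [NormedSpace 𝕜 Y]

/-- `T` is a strongly continuous semigroup `(T(t))_{t ≥ 0}` of bounded linear operators on `X`.
Only the values of `T` on `[0, ∞)` matter. -/
structure IsC0Semigroup (T : ℝ → X →L[𝕜] X) : Prop where
  map_zero : T 0 = ContinuousLinearMap.id 𝕜 X
  map_add : ∀ s t : ℝ, 0 ≤ s → 0 ≤ t → T (s + t) = T s ∘L T t
  continuousOn_orbit : ∀ x : X, ContinuousOn (fun t : ℝ => T t x) (Ici 0)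

/-- The (unbounded) operator `A` is the generator of `T`: `x ∈ dom A` and `A x = y` hold exactly
when `(T(h) x - x) / h → y` as `h ↓ 0`. -/
def IsGenerator (T : ℝ → X →L[𝕜] X) (A : X →ₗ.[𝕜] X) : Prop :=
  ∀ x y : X, (x, y) ∈ A.graph ↔
    Tendsto (fun h : ℝ => ((h⁻¹ : ℝ) : 𝕜) • (T h x - x)) (𝓝[>] 0) (𝓝 y)

/-- All orbits `t ↦ T(t) x` are differentiable on `(0, ∞)`. -/
def ImmediatelyDifferentiable (T : ℝ → X →L[𝕜] X) : Prop :=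
  letI : NormedSpace ℝ X := NormedSpace.restrictScalars ℝ 𝕜 X
  ∀ x : X, DifferentiableOn ℝ (fun t : ℝ => T t x) (Ioi 0)

/-- For an embedding `ι : V → X`: the operator `L : Y → X` has range in `V`, and as an operator
`Y → V` it is bounded with norm at most `M`. -/
def BoundedInto (ι : V →L[𝕜] X) (L : Y →L[𝕜] X) (M : ℝ) : Prop :=
  ∃ L' : Y →L[𝕜] V, ι ∘L L' = L ∧ ‖L'‖ ≤ M

open Classical in
/-- The value `B x`, extended by `0` outside `dom B` so that it can be written under an integral. -/
def total (B : X →ₗ.[𝕜] X) (x : X) : X :=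
  if h : x ∈ B.domain then B ⟨x, h⟩ else 0

end UltraPerturb

end

/-! Immediate differentiability puts `T(s)X` inside `dom A` for `s > 0`, so `F(s) = B T(s)` acts on
all of `X` and satisfies `F(s + t) = F(s) T(t)`. The perturbed semigroup is the Dyson–Phillips
series `∑ Tₙ` with `T₀ = T` and `Tₙ₊₁(t) = ∫₀ᵗ Tₙ(t - s) F(s) ds`.

Everything is first multiplied by `e^{-μt}` with `μ` large. Then (S2) yields `∫₀^∞ ‖F(s)x‖ ds ≤
q'‖x‖` with `q' = (1 + q)/2 < 1` (`isIntegrableFamily_rescale`), and the series converges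
geometrically on `X`. Uniqueness for the Volterra equation gives the semigroup law (`dysonSum_add`).
After the rescaling is undone, the generator extends `A + B`; it is no larger because `μ + 1 - A -
B` is onto (`exists_rightDeriv_sub_eq`) while the growth bound rules out the eigenvalue `μ + 1`.

For the estimate into `V`, (S3) gives `‖Tₙ(t)‖_{V→V} ≤ C ρⁿ` with `ρ = 1/2` for large `μ`. The bound
`‖Tₙ(t)‖_{X→V} ≤ E θⁿ t^{-α}` follows by induction, splitting the convolution at `δt`
(`exists_preimage_dyson_of_step`). For `s < δt` the factor `Tₙ(t - s)` is away from its singularity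
and costs only `(1 - δ)^{-α}`, which `q' < 1` absorbs for small `δ`. For `s > δt` the factor `F(s) =
F(s/2) T(s/2)` already smooths into `V`, and the estimate on `V` applies. Summing over `n` preserves
the rate `t^{-α}`. Separability of `V`, or closedness of its ball, serves to keep the integrals in
`V` (`exists_preimage_setIntegral`). -/

namespace UltraPerturb

open MeasureTheory

/-! ### Integrals of `X`-valued functions that take values in `V`. -/

section IntegralInSubspace

variable {𝕜 X V : Type*} [RCLike 𝕜]
  [NormedAddCommGroup X] [NormedSpace 𝕜 X] [NormedAddCommGroup V] [NormedSpace 𝕜 V]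

/-- Dividing by the second coordinate reduces closedness to that of the unit ball. Where the limit
of that coordinate is `0`, the preimages tend to `0` in `V` instead. -/
theorem isClosed_cone (ι : V →L[𝕜] X)
    (hV : IsClosed (ι '' Metric.closedBall (0 : V) 1)) :
    IsClosed {p : X × ℝ | ∃ v : V, ι v = p.1 ∧ ‖v‖ ≤ p.2} := by
  rw [← isSeqClosed_iff_isClosed]
  intro p p₀ hp hlim
  choose v hv hvn using hp
  have h1 : Tendsto (fun n => (p n).1) atTop (𝓝 p₀.1) := (continuous_fst.tendsto _).comp hlim
  have h2 : Tendsto (fun n => (p n).2) atTop (𝓝 p₀.2) := (continuous_snd.tendsto _).comp hlim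
  have h0 : 0 ≤ p₀.2 := ge_of_tendsto' h2 fun n => (norm_nonneg _).trans (hvn n)
  rcases h0.eq_or_lt with h0 | h0
  · refine ⟨0, ?_, by simp [← h0]⟩
    have hv0 : Tendsto v atTop (𝓝 0) :=
      squeeze_zero_norm hvn (by rw [h0]; exact h2)
    have := (ι.continuous.tendsto 0).comp hv0
    exact tendsto_nhds_unique this (by simpa [Function.comp_def, hv] using h1)
  · have hmem : ((p₀.2⁻¹ : ℝ) : 𝕜) • p₀.1 ∈ ι '' Metric.closedBall (0 : V) 1 := by
      have hlim' : Tendsto (fun n => (((p n).2⁻¹ : ℝ) : 𝕜) • (p n).1) atTop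
          (𝓝 (((p₀.2⁻¹ : ℝ) : 𝕜) • p₀.1)) :=
        ((RCLike.continuous_ofReal.tendsto _).comp (h2.inv₀ h0.ne')).smul h1
      refine hV.mem_of_tendsto hlim' ?_
      filter_upwards [h2.eventually (lt_mem_nhds h0)] with n hn
      refine ⟨(((p n).2⁻¹ : ℝ) : 𝕜) • v n, ?_, by simp [hv]⟩
      rw [mem_closedBall_zero_iff, norm_smul, RCLike.norm_ofReal, abs_of_pos (inv_pos.2 hn)]
      calc (p n).2⁻¹ * ‖v n‖ ≤ (p n).2⁻¹ * (p n).2 := by gcongr; exact hvn n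
        _ = 1 := inv_mul_cancel₀ hn.ne'
    obtain ⟨w, hw, hw'⟩ := hmem
    refine ⟨(p₀.2 : 𝕜) • w, ?_, ?_⟩
    · rw [map_smul, hw', smul_smul, ← RCLike.ofReal_mul, mul_inv_cancel₀ h0.ne']
      simp
    · rw [norm_smul, RCLike.norm_ofReal, abs_of_pos h0]
      have := mem_closedBall_zero_iff.1 hw
      nlinarith

variable [NormedSpace ℝ X] [IsScalarTower ℝ 𝕜 X] [CompleteSpace X]
  [NormedSpace ℝ V] [CompleteSpace V]

/-- The integral of a function with values in `V`, dominated in the norm of `V` by an integrable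
function, lies in `V`. -/
theorem exists_preimage_setIntegral (ι : V →L[𝕜] X) (hι : Function.Injective ι)
    (hV : TopologicalSpace.SeparableSpace V ∨ IsClosed (ι '' Metric.closedBall (0 : V) 1))
    {a b : ℝ} (hab : a < b) {h : ℝ → X} {φ : ℝ → ℝ} (hh : IntegrableOn h (Ioo a b))
    (hφ : IntegrableOn φ (Ioo a b))
    (hb : ∀ s ∈ Ioo a b, ∃ v : V, ι v = h s ∧ ‖v‖ ≤ φ s) :
    ∃ v : V, ι v = ∫ s in Ioo a b, h s ∧ ‖v‖ ≤ ∫ s in Ioo a b, φ s := by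
  rcases hV with hV | hV
  · borelize X
    borelize V
    have : SecondCountableTopology V := UniformSpace.secondCountable_of_separable V
    -- Lusin–Souslin: a continuous injection of a Polish space is a measurable embedding, so the
    -- pointwise lift of `h` to `V` is measurable and can be integrated in `V`.
    have hemb : MeasurableEmbedding ι := ι.continuous.measurableEmbedding hι
    choose! g hg hgn using hb
    have hgm : AEMeasurable g (volume.restrict (Ioo a b)) := by
      rw [← hemb.aemeasurable_comp_iff]
      refine hh.aestronglyMeasurable.aemeasurable.congr ?_
      filter_upwards [ae_restrict_mem measurableSet_Ioo] with s hs
      exact (hg s hs).symm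
    have hgi : IntegrableOn g (Ioo a b) := by
      refine hφ.mono' hgm.aestronglyMeasurable ?_
      filter_upwards [ae_restrict_mem measurableSet_Ioo] with s hs
      exact hgn s hs
    refine ⟨∫ s in Ioo a b, g s, ?_, ?_⟩
    · rw [← ι.integral_comp_comm hgi]
      exact setIntegral_congr_fun measurableSet_Ioo hg
    · refine norm_integral_le_of_norm_le hφ ?_
      filter_upwards [ae_restrict_mem measurableSet_Ioo] with s hs
      exact hgn s hs
  -- Here the lift need not be measurable. The closed convex cone `S` contains the average of `(h,
  -- φ)`, which gives membership in `V` and the norm bound together.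
  · set S : Set (X × ℝ) := {p | ∃ v : V, ι v = p.1 ∧ ‖v‖ ≤ p.2} with hS
    have hSsmul : ∀ p ∈ S, ∀ c : ℝ, 0 ≤ c → c • p ∈ S := by
      rintro p ⟨v, hv, hvn⟩ c hc
      refine ⟨(c : 𝕜) • v, ?_, ?_⟩
      · change ι ((c : 𝕜) • v) = c • p.1
        rw [map_smul, hv, RCLike.real_smul_eq_coe_smul (K := 𝕜)]
      · rw [norm_smul, RCLike.norm_ofReal, abs_of_nonneg hc]
        exact mul_le_mul_of_nonneg_left hvn hc
    have hSadd : ∀ p ∈ S, ∀ p' ∈ S, p + p' ∈ S := by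
      rintro p ⟨v, hv, hvn⟩ p' ⟨v', hv', hvn'⟩
      exact ⟨v + v', by simp [hv, hv'], (norm_add_le _ _).trans (add_le_add hvn hvn')⟩
    have hconv : Convex ℝ S := by
      intro p hp p' hp' c d hc hd _
      exact hSadd _ (hSsmul p hp c hc) _ (hSsmul p' hp' d hd)
    have hvol : volume (Ioo a b) ≠ 0 := by simpa using hab
    have hint : IntegrableOn (fun s => (h s, φ s)) (Ioo a b) := hh.prodMk hφ
    have hav := hconv.set_average_mem (isClosed_cone ι hV) hvol (by simp)
      (f := fun s => (h s, φ s)) (by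
        filter_upwards [ae_restrict_mem measurableSet_Ioo] with s hs
        exact hb s hs) hint
    have hmem := hSsmul _ hav (b - a) (sub_nonneg.2 hab.le)
    rw [setAverage_eq, smul_smul, measureReal_def, Real.volume_Ioo,
      ENNReal.toReal_ofReal (sub_nonneg.2 hab.le), mul_inv_cancel₀ (sub_pos.2 hab).ne', one_smul,
      integral_pair hh hφ] at hmem
    exact hmem

end IntegralInSubspace

/-! ### Volterra equations and the Dyson–Phillips series on `X`. -/

section Volterra

variable (𝕜 : Type*) {X : Type*} [RCLike 𝕜] [NormedAddCommGroup X] [NormedSpace 𝕜 X]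

/-- A strongly continuous family `(W(t))_{t ≥ 0}` of linear operators, bounded by `c`. -/
structure IsBoundedFamily (W : ℝ → X → X) (c : ℝ) : Prop where
  add : ∀ t, 0 ≤ t → ∀ x y, W t (x + y) = W t x + W t y
  smul : ∀ t, 0 ≤ t → ∀ (a : 𝕜) x, W t (a • x) = a • W t x
  bound : ∀ t, 0 ≤ t → ∀ x, ‖W t x‖ ≤ c * ‖x‖
  cont : ∀ x, ContinuousOn (fun t => W t x) (Ici 0)

/-- A strongly continuous family `(F(t))_{t > 0}` of linear operators whose orbits are integrable,
with integral norm at most `q`. -/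
structure IsIntegrableFamily (F : ℝ → X → X) (q : ℝ) : Prop where
  add : ∀ t, 0 < t → ∀ x y, F t (x + y) = F t x + F t y
  smul : ∀ t, 0 < t → ∀ (a : 𝕜) x, F t (a • x) = a • F t x
  cont : ∀ x, ContinuousOn (fun t => F t x) (Ioi 0)
  integrable : ∀ x, IntegrableOn (fun t => F t x) (Ioi 0)
  integral_le : ∀ x, ∫ t in Ioi 0, ‖F t x‖ ≤ q * ‖x‖

variable {𝕜} {W W' F : ℝ → X → X} {c c' q : ℝ}

namespace IsBoundedFamily

theorem sub_apply (hW : IsBoundedFamily 𝕜 W c) {t : ℝ} (ht : 0 ≤ t) (x y : X) :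
    W t (x - y) = W t x - W t y := by
  have h := hW.smul t ht (-1) y
  rw [neg_one_smul, neg_one_smul] at h
  rw [sub_eq_add_neg, hW.add t ht, h, ← sub_eq_add_neg]

theorem exists_clm (hW : IsBoundedFamily 𝕜 W c) :
    ∃ L : ℝ → X →L[𝕜] X, ∀ t, 0 ≤ t → ∀ x, L t x = W t x := by
  have : ∀ t, ∃ L : X →L[𝕜] X, 0 ≤ t → ∀ x, L x = W t x := by
    intro t
    by_cases ht : 0 ≤ t
    · exact ⟨LinearMap.mkContinuous ⟨⟨W t, hW.add t ht⟩, hW.smul t ht⟩ c (hW.bound t ht),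
        fun _ x => rfl⟩
    · exact ⟨0, fun h => absurd h ht⟩
  choose L hL using this
  exact ⟨L, hL⟩

theorem continuousOn_comp (hW : IsBoundedFamily 𝕜 W c) {f : ℝ → X} {g : ℝ → ℝ} {s : Set ℝ}
    (hf : ContinuousOn f s) (hg : ContinuousOn g s) (hgs : MapsTo g s (Ici 0)) :
    ContinuousOn (fun r => W (g r) (f r)) s := by
  intro r₀ hr₀
  have h1 : Tendsto (fun r => W (g r) (f r₀)) (𝓝[s] r₀) (𝓝 (W (g r₀) (f r₀))) :=
    ((hW.cont (f r₀)).comp hg hgs) r₀ hr₀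
  have h2 : Tendsto (fun r => W (g r) (f r - f r₀)) (𝓝[s] r₀) (𝓝 0) := by
    have h3 : Tendsto (fun r => c * ‖f r - f r₀‖) (𝓝[s] r₀) (𝓝 0) := by
      have : Tendsto (fun r => f r - f r₀) (𝓝[s] r₀) (𝓝 (f r₀ - f r₀)) := (hf r₀ hr₀).sub_const _
      simpa using this.norm.const_mul c
    refine squeeze_zero_norm' ?_ h3
    filter_upwards [self_mem_nhdsWithin] with r hr
    exact hW.bound _ (hgs hr) _
  have h4 := h2.add h1
  rw [zero_add] at h4
  refine h4.congr' ?_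
  filter_upwards [self_mem_nhdsWithin] with r hr
  rw [hW.sub_apply (hgs hr), sub_add_cancel]

theorem sub (hW : IsBoundedFamily 𝕜 W c) (hW' : IsBoundedFamily 𝕜 W' c') :
    IsBoundedFamily 𝕜 (fun t x => W t x - W' t x) (c + c') where
  add t ht x y := by rw [hW.add t ht, hW'.add t ht]; abel
  smul t ht a x := by rw [hW.smul t ht, hW'.smul t ht, smul_sub]
  bound t ht x := by
    refine (norm_sub_le _ _).trans ?_
    rw [add_mul]
    exact add_le_add (hW.bound t ht x) (hW'.bound t ht x)
  cont x := (hW.cont x).sub (hW'.cont x)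

end IsBoundedFamily

theorem integrableOn_conv (hW : IsBoundedFamily 𝕜 W c) (hF : IsIntegrableFamily 𝕜 F q)
    (t : ℝ) (x : X) : IntegrableOn (fun s => W (t - s) (F s x)) (Ioo 0 t) := by
  have hF' := ((hF.integrable x).mono_set (show Ioo 0 t ⊆ Ioi 0 from Ioo_subset_Ioi_self)).norm.const_mul c
  refine hF'.mono' ?_ ?_
  · refine ContinuousOn.aestronglyMeasurable ?_ measurableSet_Ioo
    exact hW.continuousOn_comp ((hF.cont x).mono Ioo_subset_Ioi_self) (by fun_prop)
      fun s hs => sub_nonneg.2 hs.2.le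
  · filter_upwards [ae_restrict_mem measurableSet_Ioo] with s hs
    exact hW.bound _ (sub_nonneg.2 hs.2.le) _

variable [NormedSpace ℝ X]

/-- The Volterra operator `(F ⋆ W)(t) x = ∫₀ᵗ W(t - s) F(s) x ds`. -/
noncomputable def conv (F W : ℝ → X → X) (t : ℝ) (x : X) : X :=
  ∫ s in Ioo 0 t, W (t - s) (F s x)

theorem norm_conv_le (hc : 0 ≤ c) (hW : IsBoundedFamily 𝕜 W c) (hF : IsIntegrableFamily 𝕜 F q)
    (t : ℝ) (x : X) : ‖conv F W t x‖ ≤ c * q * ‖x‖ := by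
  have hF' := ((hF.integrable x).mono_set (show Ioo 0 t ⊆ Ioi 0 from Ioo_subset_Ioi_self)).norm
  calc ‖conv F W t x‖ ≤ ∫ s in Ioo 0 t, c * ‖F s x‖ := by
        refine norm_integral_le_of_norm_le (hF'.const_mul c) ?_
        filter_upwards [ae_restrict_mem measurableSet_Ioo] with s hs
        exact hW.bound _ (sub_nonneg.2 hs.2.le) _
    _ = c * ∫ s in Ioo 0 t, ‖F s x‖ := integral_const_mul _ _
    _ ≤ c * ∫ s in Ioi 0, ‖F s x‖ := by
        refine mul_le_mul_of_nonneg_left ?_ hc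
        refine setIntegral_mono_set (hF.integrable x).norm ?_ Ioo_subset_Ioi_self.eventuallyLE
        exact Eventually.of_forall fun s => norm_nonneg _
    _ ≤ c * (q * ‖x‖) := by gcongr; exact hF.integral_le x
    _ = c * q * ‖x‖ := by ring

theorem continuous_conv (hW : IsBoundedFamily 𝕜 W c) (hF : IsIntegrableFamily 𝕜 F q) (x : X) :
    Continuous (fun t => conv F W t x) := by
  have heq : (fun t => conv F W t x) = fun t => ∫ s in Ioi 0,
      (Iio t).indicator (fun s => W (t - s) (F s x)) s := by
    funext t
    rw [conv, setIntegral_indicator measurableSet_Iio, Ioi_inter_Iio]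
  rw [heq, continuous_iff_continuousAt]
  intro t₀
  refine continuousAt_of_dominated (bound := fun s => c * ‖F s x‖) ?_ ?_
    ((hF.integrable x).norm.const_mul c) ?_
  · refine Eventually.of_forall fun t => ?_
    rw [aestronglyMeasurable_indicator_iff measurableSet_Iio,
      Measure.restrict_restrict measurableSet_Iio, Iio_inter_Ioi]
    exact (integrableOn_conv hW hF t x).aestronglyMeasurable
  · refine Eventually.of_forall fun t => ?_
    filter_upwards [ae_restrict_mem measurableSet_Ioi] with s hs
    by_cases hst : s ∈ Iio t
    · rw [indicator_of_mem hst]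
      exact hW.bound _ (sub_nonneg.2 (le_of_lt hst)) _
    · rw [indicator_of_notMem hst, norm_zero]
      exact (norm_nonneg _).trans (hW.bound 0 le_rfl _)
  -- With the integrand extended by zero to a fixed domain, continuity in `t` at `t₀` can fail only
  -- at `s = t₀`, a null set.
  · have hne : ∀ᵐ s ∂(volume.restrict (Ioi (0 : ℝ))), s ≠ t₀ :=
      ae_restrict_of_ae (Measure.ae_ne volume t₀)
    filter_upwards [hne] with s hs
    rcases lt_or_gt_of_ne hs with hs | hs
    · have hc : ContinuousAt (fun t => W (t - s) (F s x)) t₀ := by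
        have h1 := (hW.cont (F s x)).continuousAt (Ici_mem_nhds (sub_pos.2 hs))
        exact ContinuousAt.comp (f := fun t => t - s) (g := fun r => W r (F s x)) h1 (by fun_prop)
      refine hc.congr ?_
      filter_upwards [Ioi_mem_nhds hs] with t ht
      rw [indicator_of_mem (show s ∈ Iio t from ht)]
    · refine (continuousAt_const (y := (0 : X))).congr ?_
      filter_upwards [Iio_mem_nhds hs] with t ht
      rw [indicator_of_notMem (show s ∉ Iio t from fun h => lt_asymm (mem_Iio.1 h) (mem_Iio.1 ht))]

theorem IsBoundedFamily.conv [IsScalarTower ℝ 𝕜 X] (hc : 0 ≤ c) (hW : IsBoundedFamily 𝕜 W c)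
    (hF : IsIntegrableFamily 𝕜 F q) : IsBoundedFamily 𝕜 (conv F W) (c * q) where
  add t ht x y := by
    rw [UltraPerturb.conv, UltraPerturb.conv, UltraPerturb.conv,
      ← integral_add (integrableOn_conv hW hF t x) (integrableOn_conv hW hF t y)]
    refine setIntegral_congr_fun measurableSet_Ioo fun s hs => ?_
    rw [hF.add s hs.1, hW.add _ (sub_nonneg.2 hs.2.le)]
  smul t ht a x := by
    rw [UltraPerturb.conv, UltraPerturb.conv, ← integral_smul]
    refine setIntegral_congr_fun measurableSet_Ioo fun s hs => ?_
    rw [hF.smul s hs.1, hW.smul _ (sub_nonneg.2 hs.2.le)]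
  bound t _ x := norm_conv_le hc hW hF t x
  cont x := (continuous_conv hW hF x).continuousOn

/-- The Volterra equation `D = F ⋆ D` has only the trivial solution. -/
theorem eq_zero_of_eq_conv {D : ℝ → X → X} (hc : 0 ≤ c) (hD : IsBoundedFamily 𝕜 D c)
    (hF : IsIntegrableFamily 𝕜 F q) (hq0 : 0 ≤ q) (hq1 : q < 1)
    (h : ∀ t, 0 ≤ t → ∀ x, D t x = conv F D t x) {t : ℝ} (ht : 0 ≤ t) (x : X) : D t x = 0 := by
  have key : ∀ n : ℕ, IsBoundedFamily 𝕜 D (c * q ^ n) := by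
    intro n
    induction n with
    | zero => simpa using hD
    | succ n ih =>
      refine ⟨hD.add, hD.smul, fun t ht x => ?_, hD.cont⟩
      rw [h t ht x, pow_succ, ← mul_assoc]
      exact norm_conv_le (by positivity) ih hF t x
  have hlim : Tendsto (fun n : ℕ => c * q ^ n * ‖x‖) atTop (𝓝 0) := by
    simpa using ((tendsto_pow_atTop_nhds_zero_of_lt_one hq0 hq1).const_mul c).mul_const ‖x‖
  exact norm_le_zero_iff.1 (ge_of_tendsto' hlim fun n => (key n).bound t ht x)

/-- The average over `(0, h)` of `W(h - s) F(s) x` tends to `W(0) b = b`. This is how `B x` enters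
the derivative of the perturbed orbit at `0`. -/
theorem tendsto_inv_smul_conv [CompleteSpace X] (hc : 0 ≤ c) (hW : IsBoundedFamily 𝕜 W c)
    (hF : IsIntegrableFamily 𝕜 F q) {x b : X} (h0 : W 0 b = b)
    (hb : Tendsto (fun s => F s x) (𝓝[>] 0) (𝓝 b)) :
    Tendsto (fun h : ℝ => h⁻¹ • conv F W h x) (𝓝[>] 0) (𝓝 b) := by
  rw [Metric.tendsto_nhds]
  intro ε hε
  -- The denominator uses `c + 1` because `c` may vanish.
  have hcε : 0 < ε / (3 * (c + 1)) := by positivity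
  have hW0 : Tendsto (fun t => W t b) (𝓝[≥] 0) (𝓝 b) := by
    have := hW.cont b 0 self_mem_Ici
    rwa [ContinuousWithinAt, h0] at this
  obtain ⟨δ₁, hδ₁, h1⟩ := (mem_nhdsGT_iff_exists_Ioo_subset).1
    ((Metric.tendsto_nhds.1 hb) _ hcε)
  obtain ⟨δ₂, hδ₂, h2⟩ := (mem_nhdsGE_iff_exists_Ico_subset).1
    ((Metric.tendsto_nhds.1 hW0) (ε / 3) (by positivity))
  filter_upwards [Ioo_mem_nhdsGT (lt_min hδ₁ hδ₂)] with h hh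
  have hh0 : 0 < h := hh.1
  have hpt : ∀ s ∈ Ioo 0 h, ‖W (h - s) (F s x) - b‖ ≤ 2 * ε / 3 := by
    intro s hs
    have hs1 : dist (F s x) b < ε / (3 * (c + 1)) :=
      h1 ⟨hs.1, hs.2.trans (hh.2.trans_le (min_le_left _ _))⟩
    have hs2 : dist (W (h - s) b) b < ε / 3 := h2 ⟨sub_nonneg.2 hs.2.le,
      lt_of_le_of_lt (sub_le_self _ hs.1.le) (hh.2.trans_le (min_le_right _ _))⟩
    rw [dist_eq_norm] at hs1 hs2
    have hs3 := hW.bound (h - s) (sub_nonneg.2 hs.2.le) (F s x - b)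
    have hs4 : c * ‖F s x - b‖ ≤ ε / 3 := by
      calc c * ‖F s x - b‖ ≤ (c + 1) * (ε / (3 * (c + 1))) := by gcongr; linarith
        _ = ε / 3 := by field_simp
    rw [hW.sub_apply (sub_nonneg.2 hs.2.le)] at hs3
    calc ‖W (h - s) (F s x) - b‖
        = ‖(W (h - s) (F s x) - W (h - s) b) + (W (h - s) b - b)‖ := by congr 1; abel
      _ ≤ _ := norm_add_le _ _
      _ ≤ 2 * ε / 3 := by linarith
  have hint : ‖∫ s in Ioo 0 h, (W (h - s) (F s x) - b)‖ ≤ 2 * ε / 3 * h := by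
    have := norm_setIntegral_le_of_norm_le_const (μ := volume) (s := Ioo 0 h) (by simp) hpt
    simpa [measureReal_def, hh0.le] using this
  rw [integral_sub (integrableOn_conv hW hF h x) (integrableOn_const (by simp))] at hint
  have hconst : ∫ _ in Ioo 0 h, b = h • b := by simp [measureReal_def, hh0.le]
  rw [hconst] at hint
  rw [dist_eq_norm]
  calc ‖h⁻¹ • conv F W h x - b‖ = ‖h⁻¹ • (conv F W h x - h • b)‖ := by
        rw [smul_sub, smul_smul, inv_mul_cancel₀ hh0.ne', one_smul]
    _ = h⁻¹ * ‖conv F W h x - h • b‖ := by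
        rw [norm_smul, Real.norm_of_nonneg (inv_nonneg.2 hh0.le)]
    _ ≤ h⁻¹ * (2 * ε / 3 * h) := by gcongr; exact hint
    _ = 2 * ε / 3 := by field_simp
    _ < ε := by linarith

/-- The terms of the Dyson–Phillips series. -/
noncomputable def dyson (T F : ℝ → X → X) : ℕ → ℝ → X → X
  | 0 => T
  | n + 1 => conv F (dyson T F n)

variable [IsScalarTower ℝ 𝕜 X] {T : ℝ → X → X} {M : ℝ}

theorem IsBoundedFamily.dyson (hM : 0 ≤ M) (hT : IsBoundedFamily 𝕜 T M)
    (hF : IsIntegrableFamily 𝕜 F q) (hq0 : 0 ≤ q) (n : ℕ) :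
    IsBoundedFamily 𝕜 (dyson T F n) (M * q ^ n) := by
  induction n with
  | zero => simpa [UltraPerturb.dyson] using hT
  | succ n ih =>
    rw [pow_succ, ← mul_assoc]
    exact ih.conv (by positivity) hF

/-- The sum of the Dyson–Phillips series. -/
noncomputable def dysonSum (T F : ℝ → X → X) (t : ℝ) (x : X) : X := ∑' n, dyson T F n t x

section Sum

variable [CompleteSpace X] (hM : 0 ≤ M) (hT : IsBoundedFamily 𝕜 T M)
    (hF : IsIntegrableFamily 𝕜 F q) (hq0 : 0 ≤ q) (hq1 : q < 1)
include hM hT hF hq0 hq1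

theorem summable_dyson {t : ℝ} (ht : 0 ≤ t) (x : X) : Summable fun n => dyson T F n t x :=
  Summable.of_norm_bounded
    (((summable_geometric_of_lt_one hq0 hq1).mul_left M).mul_right ‖x‖)
    fun n => (hT.dyson hM hF hq0 n).bound t ht x

theorem IsBoundedFamily.dysonSum : IsBoundedFamily 𝕜 (dysonSum T F) (M * (1 - q)⁻¹) where
  add t ht x y := by
    rw [UltraPerturb.dysonSum, UltraPerturb.dysonSum, UltraPerturb.dysonSum,
      ← (summable_dyson hM hT hF hq0 hq1 ht x).tsum_add (summable_dyson hM hT hF hq0 hq1 ht y)]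
    exact tsum_congr fun n => (hT.dyson hM hF hq0 n).add t ht x y
  smul t ht a x := by
    rw [UltraPerturb.dysonSum, UltraPerturb.dysonSum,
      ← (summable_dyson hM hT hF hq0 hq1 ht x).tsum_const_smul]
    exact tsum_congr fun n => (hT.dyson hM hF hq0 n).smul t ht a x
  bound t ht x :=
    tsum_of_norm_bounded (((hasSum_geometric_of_lt_one hq0 hq1).mul_left M).mul_right ‖x‖)
      fun n => (hT.dyson hM hF hq0 n).bound t ht x
  cont x := by
    refine continuousOn_tsum (u := fun n => M * q ^ n * ‖x‖)
      (fun n => (hT.dyson hM hF hq0 n).cont x)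
      (((summable_geometric_of_lt_one hq0 hq1).mul_left M).mul_right ‖x‖)
      fun n t ht => (hT.dyson hM hF hq0 n).bound t ht x

/-- The geometric bounds on the terms allow summation under the integral, which turns the recursion
into the Volterra equation. -/
theorem dysonSum_eq {t : ℝ} (ht : 0 ≤ t) (x : X) :
    dysonSum T F t x = T t x + conv F (dysonSum T F) t x := by
  have hint : ∀ n, IntegrableOn (fun s => dyson T F n (t - s) (F s x)) (Ioo 0 t) := fun n =>
    integrableOn_conv (hT.dyson hM hF hq0 n) hF t x
  have hFi := ((hF.integrable x).mono_set (show Ioo 0 t ⊆ Ioi 0 from Ioo_subset_Ioi_self)).norm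
  have hsum : Summable fun n => ∫ s in Ioo 0 t, ‖dyson T F n (t - s) (F s x)‖ := by
    refine Summable.of_nonneg_of_le (fun n => integral_nonneg fun s => norm_nonneg _) (fun n => ?_)
      (((summable_geometric_of_lt_one hq0 hq1).mul_left M).mul_right
        (∫ s in Ioo 0 t, ‖F s x‖))
    rw [← integral_const_mul]
    refine setIntegral_mono_on (hint n).norm (hFi.const_mul _) measurableSet_Ioo fun s hs => ?_
    exact (hT.dyson hM hF hq0 n).bound _ (sub_nonneg.2 hs.2.le) _
  have h1 := (hasSum_integral_of_summable_integral_norm hint hsum).tsum_eq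
  rw [dysonSum, (summable_dyson hM hT hF hq0 hq1 ht x).tsum_eq_zero_add]
  exact congrArg (T t x + ·) h1

/-- For fixed `r`, both `U(r + t)` and `U(r) U(t)` solve, in `t`, the Volterra equation with
inhomogeneity `U(r) T(t)`. Their difference solves the homogeneous equation and vanishes. -/
theorem dysonSum_add (hTadd : ∀ s t, 0 ≤ s → 0 ≤ t → ∀ x, T (s + t) x = T s (T t x))
    (hFadd : ∀ s t, 0 < s → 0 ≤ t → ∀ x, F (s + t) x = F s (T t x)) {r t : ℝ} (hr : 0 ≤ r)
    (ht : 0 ≤ t) (x : X) : dysonSum T F (r + t) x = dysonSum T F r (dysonSum T F t x) := by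
  have hU := IsBoundedFamily.dysonSum hM hT hF hq0 hq1
  have hUeq := fun {t} (ht : 0 ≤ t) x => dysonSum_eq (t := t) hM hT hF hq0 hq1 ht x
  set U := UltraPerturb.dysonSum T F with hUdef
  set c := M * (1 - q)⁻¹ with hcdef
  have hc : 0 ≤ c := mul_nonneg hM (inv_nonneg.2 (sub_nonneg.2 hq1.le))
  obtain ⟨L, hL⟩ := hU.exists_clm
  have h1 : IsBoundedFamily 𝕜 (fun t x => U (r + t) x) c :=
    ⟨fun t ht => hU.add _ (add_nonneg hr ht), fun t ht => hU.smul _ (add_nonneg hr ht),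
      fun t ht => hU.bound _ (add_nonneg hr ht), fun x => (hU.cont x).comp (by fun_prop)
        fun t ht => add_nonneg hr ht⟩
  have h2 : IsBoundedFamily 𝕜 (fun t x => U r (U t x)) (c * c) := by
    refine ⟨fun t ht x y => ?_, fun t ht a x => ?_, fun t ht x => ?_, fun x => ?_⟩
    · rw [hU.add t ht, hU.add r hr]
    · rw [hU.smul t ht, hU.smul r hr]
    · rw [mul_assoc]
      exact (hU.bound r hr _).trans (mul_le_mul_of_nonneg_left (hU.bound t ht x) hc)
    · exact hU.continuousOn_comp (hU.cont x) continuousOn_const fun t ht => hr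
  have hD := h1.sub h2
  refine sub_eq_zero.1 (eq_zero_of_eq_conv (by positivity) hD hF hq0 hq1 ?_ ht x)
  clear ht x t
  intro t ht x
  -- Split the integral at `t`; on `(t, r + t)` translate by `t` and use `F(s + t) = F(s) T(t)`.
  have hconv : conv F U (r + t) x = conv F U r (T t x) +
      ∫ s in Ioo 0 t, U (r + (t - s)) (F s x) := by
    have hi := integrableOn_conv hU hF (r + t) x
    rw [conv, ← integral_Ioc_eq_integral_Ioo, ← intervalIntegral.integral_of_le (by positivity)]
    rw [← integrableOn_Ioc_iff_integrableOn_Ioo] at hi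
    rw [← intervalIntegral.integral_add_adjacent_intervals (b := t), add_comm]
    · congr 1
      · rw [conv, ← integral_Ioc_eq_integral_Ioo, ← intervalIntegral.integral_of_le hr]
        have := intervalIntegral.integral_comp_add_right (a := 0) (b := r)
          (fun s => U (r + t - s) (F s x)) t
        rw [zero_add] at this
        rw [← this]
        refine intervalIntegral.integral_congr_ae (Eventually.of_forall fun s hs => ?_)
        rw [uIoc_of_le hr] at hs
        rw [hFadd s t hs.1 ht]
        congr 1
        ring
      · rw [intervalIntegral.integral_of_le ht, integral_Ioc_eq_integral_Ioo]
        simp only [add_sub_assoc]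
    · rw [intervalIntegrable_iff_integrableOn_Ioc_of_le ht]
      exact hi.mono_set (Ioc_subset_Ioc_right (by linarith))
    · rw [intervalIntegrable_iff_integrableOn_Ioc_of_le (by linarith)]
      exact hi.mono_set (Ioc_subset_Ioc_left ht)
  have hint2 := integrableOn_conv h2 hF t x
  have hint1 := integrableOn_conv h1 hF t x
  have hcomm : U r (conv F U t x) = ∫ s in Ioo 0 t, U r (U (t - s) (F s x)) := by
    rw [← hL r hr, conv, ← (L r).integral_comp_comm (integrableOn_conv hU hF t x)]
    simp only [hL r hr]
  have hsub : conv F (fun t x => U (r + t) x - U r (U t x)) t x =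
      (∫ s in Ioo 0 t, U (r + (t - s)) (F s x)) - ∫ s in Ioo 0 t, U r (U (t - s) (F s x)) :=
    integral_sub hint1 hint2
  rw [hsub, hUeq (add_nonneg hr ht) x, hconv, ← hcomm]
  rw [hUeq ht x, hU.add r hr, hUeq hr (T t x), hTadd r t hr ht]
  abel

end Sum

end Volterra

/-! ### Estimates for the Dyson–Phillips terms in the norm of `V`. -/

section DysonInSubspace

variable {𝕜 X V : Type*} [RCLike 𝕜]
  [NormedAddCommGroup X] [NormedSpace 𝕜 X] [NormedSpace ℝ X] [IsScalarTower ℝ 𝕜 X]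
  [CompleteSpace X]
  [NormedAddCommGroup V] [NormedSpace 𝕜 V] [NormedSpace ℝ V] [CompleteSpace V]
  {ι : V →L[𝕜] X} (hι : Function.Injective ι)
  (hV : TopologicalSpace.SeparableSpace V ∨ IsClosed (ι '' Metric.closedBall (0 : V) 1))
  {T F : ℝ → X → X} {M q C α β ρ : ℝ} {k : ℝ → ℝ}
  (hM : 0 ≤ M) (hT : IsBoundedFamily 𝕜 T M) (hF : IsIntegrableFamily 𝕜 F q)
  (hq0 : 0 ≤ q) (hq1 : q < 1) (hC : 0 ≤ C)
  (hVV : ∀ t ∈ Ioc (0 : ℝ) 1, ∀ v, ∃ w : V, ι w = T t (ι v) ∧ ‖w‖ ≤ C * ‖v‖)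
  (hFV : ∀ t ∈ Ioc (0 : ℝ) 1, ∀ v, ∃ w : V, ι w = F t (ι v) ∧ ‖w‖ ≤ k t * ‖v‖)
  (hk : IntegrableOn k (Ioo 0 1)) (hk0 : ∀ t ∈ Ioo (0 : ℝ) 1, 0 ≤ k t)
  (hkρ : ∫ t in Ioo 0 1, k t ≤ ρ) (hρ0 : 0 ≤ ρ) (hρ1 : ρ < 1)

include hι hV hM hT hF hq0 hC hVV hFV hk hk0 hkρ hρ0 in
-- On `V` the kernel `F` has an integrable norm bound `k` of mass at most `ρ`, so each convolution
-- costs a factor `ρ`.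
theorem exists_preimage_dyson (n : ℕ) {t : ℝ} (ht : t ∈ Ioc (0 : ℝ) 1) (v : V) :
    ∃ w : V, ι w = dyson T F n t (ι v) ∧ ‖w‖ ≤ C * ρ ^ n * ‖v‖ := by
  induction n generalizing t v with
  | zero => simpa [dyson] using hVV t ht v
  | succ n ih =>
    have hsub : Ioo 0 t ⊆ Ioo 0 1 := Ioo_subset_Ioo_right ht.2
    obtain ⟨w, hw, hwn⟩ := exists_preimage_setIntegral ι hι hV ht.1
      (h := fun s => dyson T F n (t - s) (F s (ι v)))
      (φ := fun s => C * ρ ^ n * ‖v‖ * k s)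
      (integrableOn_conv (hT.dyson hM hF hq0 n) hF t (ι v))
      ((hk.mono_set hsub).const_mul _) (by
        intro s hs
        obtain ⟨u, hu, hun⟩ := hFV s ⟨hs.1, hs.2.le.trans ht.2⟩ v
        obtain ⟨w, hw, hwn⟩ := ih (t := t - s) ⟨sub_pos.2 hs.2, by linarith [hs.1, ht.2]⟩ u
        refine ⟨w, by rw [hw, hu], hwn.trans ?_⟩
        calc C * ρ ^ n * ‖u‖ ≤ C * ρ ^ n * (k s * ‖v‖) := by gcongr
          _ = C * ρ ^ n * ‖v‖ * k s := by ring)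
    refine ⟨w, hw, hwn.trans ?_⟩
    rw [integral_const_mul]
    have hle : ∫ s in Ioo 0 t, k s ≤ ρ := by
      refine (setIntegral_mono_set hk ?_ hsub.eventuallyLE).trans hkρ
      filter_upwards [ae_restrict_mem measurableSet_Ioo] with s hs
      exact hk0 s hs
    calc C * ρ ^ n * ‖v‖ * ∫ s in Ioo 0 t, k s ≤ C * ρ ^ n * ‖v‖ * ρ := by
          refine mul_le_mul_of_nonneg_left hle (by positivity)
      _ = C * ρ ^ (n + 1) * ‖v‖ := by ring

variable (hα : 0 < α) (hβ : β < 1)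
  (hXV : ∀ t ∈ Ioc (0 : ℝ) 1, ∀ x, ∃ v : V, ι v = T t x ∧ ‖v‖ ≤ C * t ^ (-α) * ‖x‖)
  (hkβ : ∀ t ∈ Ioo (0 : ℝ) 1, k t ≤ C * t ^ (-β))
  (hFadd : ∀ s t, 0 < s → 0 ≤ t → ∀ x, F (s + t) x = F s (T t x))

theorem integrableOn_half_rpow (hβ : β < 1) :
    IntegrableOn (fun s : ℝ => (s / 2) ^ (-β)) (Ioo 0 1) := by
  have h : IntegrableOn (fun s : ℝ => s ^ (-β) * 2⁻¹ ^ (-β)) (Ioo 0 1) :=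
    ((intervalIntegral.integrableOn_Ioo_rpow_iff one_pos).2 (by linarith)).mul_const _
  refine h.congr_fun (fun s hs => ?_) measurableSet_Ioo
  simp only
  rw [div_eq_mul_inv, Real.mul_rpow hs.1.le (by norm_num)]

include hι hV hM hT hF hq0 hC hVV hFV hk hk0 hkρ hρ0 hα hβ hXV hkβ hFadd in
-- The first summand in `hE` comes from `s < δt`, where the induction hypothesis is used, and the
-- second from `s > δt`, where smoothing by `T(s/2)` and the bound on `V` are used. Since `ρ ≤ θ`,
-- the same `E` serves every `n`.
theorem exists_preimage_dyson_of_step {δ θ E : ℝ} (hδ : δ ∈ Ioo (0 : ℝ) 1) (hρθ : ρ ≤ θ)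
    (hE0 : 0 ≤ E) (hCE : C ≤ E)
    (hE : q * (1 - δ) ^ (-α) * E +
      C * C * C * (δ / 2) ^ (-α) * (∫ s in Ioo (0 : ℝ) 1, (s / 2) ^ (-β)) ≤ θ * E)
    (n : ℕ) {t : ℝ} (ht : t ∈ Ioc (0 : ℝ) 1) (x : X) :
    ∃ w : V, ι w = dyson T F n t x ∧ ‖w‖ ≤ E * θ ^ n * t ^ (-α) * ‖x‖ := by
  have hθ0 : 0 ≤ θ := hρ0.trans hρθ
  induction n generalizing t x with
  | zero =>
    obtain ⟨v, hv, hvn⟩ := hXV t ht x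
    refine ⟨v, hv, hvn.trans ?_⟩
    have := Real.rpow_nonneg ht.1.le (-α)
    rw [pow_zero, mul_one]
    gcongr
  | succ n ih =>
    have ht0 := ht.1
    have hδt : 0 < δ * t := mul_pos hδ.1 ht.1
    have hδtt : δ * t < t := by nlinarith [hδ.2, ht.1]
    have h1δ : 0 < 1 - δ := sub_pos.2 hδ.2
    have hδ0 := hδ.1
    have hint := integrableOn_conv (hT.dyson hM hF hq0 n) hF t x
    have hFi : IntegrableOn (fun s => ‖F s x‖) (Ioo 0 (δ * t)) :=
      ((hF.integrable x).mono_set Ioo_subset_Ioi_self).norm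
    obtain ⟨w₁, hw₁, hwn₁⟩ := exists_preimage_setIntegral ι hι hV hδt
      (h := fun s => dyson T F n (t - s) (F s x))
      (φ := fun s => E * θ ^ n * ((1 - δ) * t) ^ (-α) * ‖F s x‖)
      (hint.mono_set (Ioo_subset_Ioo_right hδtt.le)) (hFi.const_mul _) (by
        intro s hs
        have hst : (1 - δ) * t ≤ t - s := by linarith [hs.2]
        obtain ⟨w, hw, hwn⟩ := ih (t := t - s)
          ⟨by linarith [mul_pos h1δ ht0], by linarith [hs.1, ht.2]⟩ (F s x)
        refine ⟨w, hw, hwn.trans ?_⟩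
        have : (t - s) ^ (-α) ≤ ((1 - δ) * t) ^ (-α) :=
          Real.rpow_le_rpow_of_nonpos (by positivity) hst (by linarith)
        gcongr)
    have hsub : Ioo (δ * t) t ⊆ Ioo 0 1 := Ioo_subset_Ioo hδt.le ht.2
    have hβi := integrableOn_half_rpow hβ
    obtain ⟨w₂, hw₂, hwn₂⟩ := exists_preimage_setIntegral ι hι hV hδtt
      (h := fun s => dyson T F n (t - s) (F s x))
      (φ := fun s => C * ρ ^ n * (C * C * (δ * t / 2) ^ (-α) * ‖x‖) * (s / 2) ^ (-β))
      (hint.mono_set (Ioo_subset_Ioo_left hδt.le)) ((hβi.mono_set hsub).const_mul _) (by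
        intro s hs
        have hs0 : 0 < s := hδt.trans hs.1
        have hs1 : s < 1 := hs.2.trans_le ht.2
        have hs2 : s / 2 ∈ Ioo (0 : ℝ) 1 := ⟨by linarith, by linarith⟩
        obtain ⟨u, hu, hun⟩ := hXV (s / 2) ⟨hs2.1, hs2.2.le⟩ x
        obtain ⟨y, hy, hyn⟩ := hFV (s / 2) ⟨hs2.1, hs2.2.le⟩ u
        obtain ⟨w, hw, hwn⟩ := exists_preimage_dyson hι hV hM hT hF hq0 hC hVV hFV hk hk0 hkρ hρ0
          n (t := t - s) ⟨sub_pos.2 hs.2, by linarith [ht.2]⟩ y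
        -- `T(s/2)` carries `X` into `V` at cost at most `C (δt/2)^{-α}`. `F(s/2)` then acts within
        -- `V`, leaving only the integrable singularity `(s/2)^{-β}`.
        have hFs : F s x = F (s / 2) (T (s / 2) x) := by
          rw [← hFadd (s / 2) (s / 2) hs2.1 hs2.1.le, add_halves]
        refine ⟨w, by rw [hw, hy, hu, hFs], hwn.trans ?_⟩
        have h1 : (s / 2) ^ (-α) ≤ (δ * t / 2) ^ (-α) :=
          Real.rpow_le_rpow_of_nonpos (by positivity) (by linarith [hs.1]) (by linarith)
        have h2 := Real.rpow_nonneg hs2.1.le (-β)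
        have h3 := Real.rpow_nonneg hs2.1.le (-α)
        calc C * ρ ^ n * ‖y‖ ≤ C * ρ ^ n *
              ((C * (s / 2) ^ (-β)) * (C * (δ * t / 2) ^ (-α) * ‖x‖)) := by
              gcongr
              refine hyn.trans ?_
              have := hkβ _ hs2
              calc k (s / 2) * ‖u‖ ≤ (C * (s / 2) ^ (-β)) * ‖u‖ := by gcongr
                _ ≤ _ := by
                  gcongr
                  refine hun.trans ?_
                  gcongr
          _ = _ := by ring)
    refine ⟨w₁ + w₂, ?_, ?_⟩
    · have hi' := hint
      rw [← integrableOn_Ioc_iff_integrableOn_Ioo] at hi'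
      rw [map_add, hw₁, hw₂, dyson, conv]
      simp only [← integral_Ioc_eq_integral_Ioo]
      rw [← intervalIntegral.integral_of_le hδt.le, ← intervalIntegral.integral_of_le hδtt.le,
        ← intervalIntegral.integral_of_le ht0.le]
      refine intervalIntegral.integral_add_adjacent_intervals ?_ ?_
      · rw [intervalIntegrable_iff_integrableOn_Ioc_of_le hδt.le]
        exact hi'.mono_set (Ioc_subset_Ioc_right hδtt.le)
      · rw [intervalIntegrable_iff_integrableOn_Ioc_of_le hδtt.le]
        exact hi'.mono_set (Ioc_subset_Ioc_left hδt.le)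
    · rw [integral_const_mul] at hwn₁ hwn₂
      have hI1 : ∫ s in Ioo 0 (δ * t), ‖F s x‖ ≤ q * ‖x‖ := by
        refine (setIntegral_mono_set (hF.integrable x).norm ?_
          Ioo_subset_Ioi_self.eventuallyLE).trans (hF.integral_le x)
        exact Eventually.of_forall fun s => norm_nonneg _
      have hI2 : ∫ s in Ioo (δ * t) t, (s / 2) ^ (-β) ≤ ∫ s in Ioo (0 : ℝ) 1, (s / 2) ^ (-β) := by
        refine setIntegral_mono_set hβi ?_ hsub.eventuallyLE
        filter_upwards [ae_restrict_mem measurableSet_Ioo] with s hs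
        exact Real.rpow_nonneg (by linarith [hs.1]) _
      set I := ∫ s in Ioo (0 : ℝ) 1, (s / 2) ^ (-β) with hI
      have hI0 : 0 ≤ I := setIntegral_nonneg measurableSet_Ioo fun s hs =>
        Real.rpow_nonneg (by linarith [hs.1]) _
      rw [Real.mul_rpow h1δ.le ht0.le] at hwn₁
      rw [mul_div_right_comm, Real.mul_rpow (by positivity) ht0.le] at hwn₂
      set τ := t ^ (-α) with hτ
      have hτ0 : 0 ≤ τ := Real.rpow_nonneg ht0.le _
      set a := (1 - δ) ^ (-α) with ha
      have ha0 : 0 ≤ a := Real.rpow_nonneg h1δ.le _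
      set d := (δ / 2) ^ (-α) with hd
      have hd0 : 0 ≤ d := Real.rpow_nonneg (by positivity) _
      calc ‖w₁ + w₂‖ ≤ ‖w₁‖ + ‖w₂‖ := norm_add_le _ _
        _ ≤ E * θ ^ n * (a * τ) * (q * ‖x‖) + C * θ ^ n * (C * C * (d * τ) * ‖x‖) * I := by
          refine add_le_add (hwn₁.trans ?_) (hwn₂.trans ?_)
          · exact mul_le_mul_of_nonneg_left hI1 (by positivity)
          · refine mul_le_mul ?_ hI2 ?_ (by positivity)
            · gcongr
            · exact setIntegral_nonneg measurableSet_Ioo fun s hs =>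
                Real.rpow_nonneg (by linarith [hs.1]) _
        _ = θ ^ n * τ * ‖x‖ * (q * a * E + C * C * C * d * I) := by ring
        _ ≤ θ ^ n * τ * ‖x‖ * (θ * E) := mul_le_mul_of_nonneg_left hE (by positivity)
        _ = E * θ ^ (n + 1) * τ * ‖x‖ := by ring

include hι hV hM hT hF hq0 hq1 hC hVV hFV hk hk0 hkρ hρ0 hρ1 hα hβ hXV hkβ hFadd in
theorem exists_preimage_dysonSum : ∃ C' : ℝ, 0 < C' ∧ ∀ t ∈ Ioc (0 : ℝ) 1, ∀ x,
    ∃ w : V, ι w = dysonSum T F t x ∧ ‖w‖ ≤ C' * t ^ (-α) * ‖x‖ := by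
  obtain ⟨δ, hδ, hδq⟩ : ∃ δ ∈ Ioo (0 : ℝ) 1, q * (1 - δ) ^ (-α) < 1 := by
    have hcont : ContinuousAt (fun δ : ℝ => q * (1 - δ) ^ (-α)) 0 := by
      refine continuousAt_const.mul (ContinuousAt.rpow_const (by fun_prop) (Or.inl (by norm_num)))
    have hlt : ∀ᶠ δ in 𝓝[>] (0 : ℝ), q * (1 - δ) ^ (-α) < 1 :=
      (hcont.eventually (gt_mem_nhds (by simpa using hq1))).filter_mono nhdsWithin_le_nhds
    obtain ⟨δ, h1, h2⟩ := (hlt.and (Ioo_mem_nhdsGT one_pos)).exists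
    exact ⟨δ, h2, h1⟩
  set q' := q * (1 - δ) ^ (-α) with hq'
  -- `θ` must lie strictly between `q'` and `1` and dominate `ρ`; then `q' E + D ≤ θ E` holds as
  -- soon as `E ≥ D / (θ - q')`.
  set θ := max ((q' + 1) / 2) ρ with hθ
  have hθq : q' < θ := lt_of_lt_of_le (by linarith) (le_max_left _ _)
  have hθ1 : θ < 1 := max_lt (by linarith) hρ1
  have hθ0 : 0 ≤ θ := hρ0.trans (le_max_right _ _)
  set D := C * C * C * (δ / 2) ^ (-α) * (∫ s in Ioo (0 : ℝ) 1, (s / 2) ^ (-β)) with hD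
  set E := max (max C 1) (D / (θ - q')) with hE
  have hE1 : 1 ≤ E := (le_max_right _ _).trans (le_max_left _ _)
  have hEstep : q' * E + D ≤ θ * E := by
    have : D / (θ - q') ≤ E := le_max_right _ _
    rw [div_le_iff₀ (sub_pos.2 hθq)] at this
    linarith
  have h1θ : 0 < 1 - θ := sub_pos.2 hθ1
  refine ⟨E * (1 - θ)⁻¹, by positivity, fun t ht x => ?_⟩
  choose w hw hwn using fun n => exists_preimage_dyson_of_step hι hV hM hT hF hq0 hC hVV hFV hk hk0
    hkρ hρ0 hα hβ hXV hkβ hFadd hδ (le_max_right _ _) (zero_le_one.trans hE1)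
    ((le_max_left _ _).trans (le_max_left _ _)) hEstep n ht x
  have hg := (((hasSum_geometric_of_lt_one hθ0 hθ1).mul_left E).mul_right (t ^ (-α))).mul_right ‖x‖
  have hs : Summable w := Summable.of_norm_bounded hg.summable hwn
  refine ⟨∑' n, w n, ?_, tsum_of_norm_bounded hg hwn⟩
  rw [ι.map_tsum hs, dysonSum]
  simp only [hw]

end DysonInSubspace

/-! ### Generators as right derivatives at zero, uniqueness, and exponential rescaling. -/

section Semigroup

variable {𝕜 X : Type*} [RCLike 𝕜] [NormedAddCommGroup X] [NormedSpace 𝕜 X]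

theorem IsC0Semigroup.exists_norm_le [CompleteSpace X] {T : ℝ → X →L[𝕜] X}
    (hT : IsC0Semigroup T) (b : ℝ) : ∃ M, 1 ≤ M ∧ ∀ t ∈ Icc 0 b, ‖T t‖ ≤ M := by
  obtain ⟨M, hM⟩ := banach_steinhaus (g := fun t : Icc (0 : ℝ) b => T t) (fun x => by
    obtain ⟨c, hc⟩ := isCompact_Icc.exists_bound_of_continuousOn
      ((hT.continuousOn_orbit x).mono (show Icc 0 b ⊆ Ici 0 from Icc_subset_Ici_self))
    exact ⟨c, fun t => hc t t.2⟩)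
  exact ⟨max 1 M, le_max_left _ _, fun t ht => (hM ⟨t, ht⟩).trans (le_max_right _ _)⟩

theorem IsC0Semigroup.add_apply {T : ℝ → X →L[𝕜] X} (hT : IsC0Semigroup T) {s t : ℝ} (hs : 0 ≤ s)
    (ht : 0 ≤ t) (x : X) : T (s + t) x = T s (T t x) := by
  rw [hT.map_add s t hs ht]; rfl

theorem IsC0Semigroup.zero_apply {T : ℝ → X →L[𝕜] X} (hT : IsC0Semigroup T) (x : X) :
    T 0 x = x := by
  rw [hT.map_zero]; rfl

theorem IsC0Semigroup.tendsto_zero {T : ℝ → X →L[𝕜] X} (hT : IsC0Semigroup T) (x : X) :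
    Tendsto (fun h => T h x) (𝓝[>] 0) (𝓝 x) := by
  have := (hT.continuousOn_orbit x 0 self_mem_Ici).mono Ioi_subset_Ici_self
  rwa [ContinuousWithinAt, hT.zero_apply] at this

theorem IsC0Semigroup.intervalIntegrable {T : ℝ → X →L[𝕜] X} (hT : IsC0Semigroup T) (x : X)
    {a b : ℝ} (ha : 0 ≤ a) (hb : 0 ≤ b) : IntervalIntegrable (fun s => T s x) volume a b :=
  ((hT.continuousOn_orbit x).mono fun _ hs => (le_min ha hb).trans hs.1).intervalIntegrable

variable [NormedSpace ℝ X]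

/-- The orbit of `x` has right derivative `y` at `0`. -/
def RightDeriv (T : ℝ → X →L[𝕜] X) (x y : X) : Prop :=
  Tendsto (fun h : ℝ => h⁻¹ • (T h x - x)) (𝓝[>] 0) (𝓝 y)

theorem hasDerivWithinAt_Ici_iff_tendsto {E : Type*} [NormedAddCommGroup E] [NormedSpace ℝ E]
    {f : ℝ → E} {y : E} {t : ℝ} :
    HasDerivWithinAt f y (Ici t) t ↔
      Tendsto (fun h : ℝ => h⁻¹ • (f (t + h) - f t)) (𝓝[>] 0) (𝓝 y) := by
  rw [← hasDerivWithinAt_Ioi_iff_Ici, hasDerivWithinAt_iff_tendsto_slope' self_notMem_Ioi]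
  have hmap : map (fun h : ℝ => t + h) (𝓝[>] 0) = 𝓝[>] t := by simp
  rw [← hmap, tendsto_map'_iff]
  simp [Function.comp_def, slope, vsub_eq_sub]

theorem isGenerator_iff [IsScalarTower ℝ 𝕜 X] {T : ℝ → X →L[𝕜] X} {A : X →ₗ.[𝕜] X} :
    IsGenerator T A ↔ ∀ x y, (x, y) ∈ A.graph ↔ RightDeriv T x y := by
  simp only [IsGenerator, RightDeriv, RCLike.real_smul_eq_coe_smul (K := 𝕜)]

namespace RightDeriv

variable {T : ℝ → X →L[𝕜] X} {x x' y y' : X}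

theorem add (h : RightDeriv T x y) (h' : RightDeriv T x' y') :
    RightDeriv T (x + x') (y + y') := by
  refine (Tendsto.add h h').congr fun r => ?_
  rw [← smul_add, map_add]
  congr 1; abel

theorem sub (h : RightDeriv T x y) (h' : RightDeriv T x' y') :
    RightDeriv T (x - x') (y - y') := by
  refine (Tendsto.sub h h').congr fun r => ?_
  rw [← smul_sub, map_sub]
  congr 1; abel

theorem smul [IsScalarTower ℝ 𝕜 X] (c : 𝕜) (h : RightDeriv T x y) :
    RightDeriv T (c • x) (c • y) := by
  refine (Tendsto.const_smul h c).congr fun r => ?_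
  rw [map_smul, ← smul_sub, RCLike.real_smul_eq_coe_smul (K := 𝕜),
    RCLike.real_smul_eq_coe_smul (K := 𝕜), smul_comm]

theorem zero : RightDeriv T 0 0 := by
  simp [RightDeriv]

theorem apply [IsScalarTower ℝ 𝕜 X] (hT : IsC0Semigroup T) (h : RightDeriv T x y) {s : ℝ}
    (hs : 0 ≤ s) : RightDeriv T (T s x) (T s y) := by
  refine (((T s).continuous.tendsto y).comp h).congr' ?_
  filter_upwards [self_mem_nhdsWithin] with r hr
  rw [Function.comp_apply, RCLike.real_smul_eq_coe_smul (K := 𝕜), map_smul, map_sub,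
    ← hT.add_apply hs (le_of_lt hr), ← hT.add_apply (le_of_lt hr) hs, add_comm s r,
    RCLike.real_smul_eq_coe_smul (K := 𝕜)]

theorem hasDerivWithinAt [IsScalarTower ℝ 𝕜 X] (hT : IsC0Semigroup T) (h : RightDeriv T x y)
    {t : ℝ} (ht : 0 ≤ t) : HasDerivWithinAt (fun t => T t x) (T t y) (Ici t) t := by
  rw [hasDerivWithinAt_Ici_iff_tendsto]
  refine Tendsto.congr' ?_ (h.apply hT ht)
  filter_upwards [self_mem_nhdsWithin] with r hr
  rw [add_comm t r, ← hT.add_apply (le_of_lt hr) ht]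

theorem integral_eq [IsScalarTower ℝ 𝕜 X] [CompleteSpace X] (hT : IsC0Semigroup T)
    (h : RightDeriv T x y) {t : ℝ} (ht : 0 ≤ t) : ∫ s in (0 : ℝ)..t, T s y = T t x - x := by
  have hsub : uIcc 0 t ⊆ Ici 0 := by rw [uIcc_of_le ht]; exact Icc_subset_Ici_self
  have := intervalIntegral.integral_eq_sub_of_hasDeriv_right (f := fun s => T s x)
    (f' := fun s => T s y) ((hT.continuousOn_orbit x).mono hsub) (fun s hs => by
      rw [min_eq_left ht] at hs
      exact (h.hasDerivWithinAt hT hs.1.le).mono Ioi_subset_Ici_self)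
    ((hT.continuousOn_orbit y).mono hsub).intervalIntegrable
  rwa [hT.zero_apply] at this

end RightDeriv

theorem IsC0Semigroup.rightDeriv_integral [CompleteSpace X]
    {T : ℝ → X →L[𝕜] X} (hT : IsC0Semigroup T) (w : X) {τ : ℝ} (hτ : 0 ≤ τ) :
    RightDeriv T (∫ s in (0 : ℝ)..τ, T s w) (T τ w - w) := by
  have hd : ∀ t, 0 ≤ t →
      Tendsto (fun h : ℝ => h⁻¹ • ((∫ s in (0 : ℝ)..t + h, T s w) - ∫ s in (0 : ℝ)..t, T s w))
        (𝓝[>] 0) (𝓝 (T t w)) := by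
    intro t ht
    refine (hasDerivWithinAt_Ici_iff_tendsto (f := fun u => ∫ s in (0 : ℝ)..u, T s w)).1 ?_
    have hc : ContinuousWithinAt (fun s => T s w) (Ici t) t :=
      (hT.continuousOn_orbit w t ht).mono (Ici_subset_Ici.2 ht)
    refine intervalIntegral.integral_hasDerivWithinAt_right
      (hT.intervalIntegrable w le_rfl ht) (t := Ioi t) ?_
      (hc.mono Ioi_subset_Ici_self)
    refine ⟨Ioi t, self_mem_nhdsWithin, ?_⟩
    exact ((hT.continuousOn_orbit w).mono fun s hs => ht.trans (le_of_lt hs)).aestronglyMeasurable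
      measurableSet_Ioi
  have h1 := hd τ hτ
  have h2 := hd 0 le_rfl
  rw [hT.zero_apply] at h2
  refine (h1.sub h2).congr' ?_
  filter_upwards [self_mem_nhdsWithin] with h hh
  have hh0 : 0 ≤ h := le_of_lt hh
  rw [← smul_sub]
  congr 1
  have hcomm : T h (∫ s in (0 : ℝ)..τ, T s w) = ∫ s in h..(τ + h), T s w := by
    rw [← (T h).intervalIntegral_comp_comm (hT.intervalIntegrable w le_rfl hτ)]
    have := intervalIntegral.integral_comp_add_right (a := 0) (b := τ) (fun s => T s w) h
    rw [zero_add] at this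
    rw [← this]
    refine intervalIntegral.integral_congr fun s hs => ?_
    rw [uIcc_of_le hτ] at hs
    rw [add_comm s h, hT.add_apply hh0 hs.1]
  have hadd := intervalIntegral.integral_add_adjacent_intervals
    (hT.intervalIntegrable w le_rfl hh0) (hT.intervalIntegrable w hh0 (add_nonneg hτ hh0))
  rw [hcomm, ← hadd, zero_add, intervalIntegral.integral_same]
  abel

/-- A semigroup whose generator extends that of `S` coincides with `S`. -/
theorem IsC0Semigroup.eq_of_rightDeriv [IsScalarTower ℝ 𝕜 X] [CompleteSpace X]
    {S S' : ℝ → X →L[𝕜] X} (hS : IsC0Semigroup S) (hS' : IsC0Semigroup S')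
    (h : ∀ x y, RightDeriv S x y → RightDeriv S' x y)
    (hdense : Dense {x | ∃ y, RightDeriv S x y}) {t : ℝ} (ht : 0 ≤ t) : S' t = S t := by
  obtain ⟨M, hM1, hM⟩ := hS'.exists_norm_le t
  have hM0 : 0 ≤ M := zero_le_one.trans hM1
  refine ContinuousLinearMap.coeFn_injective (Continuous.ext_on hdense (S' t).continuous
    (S t).continuous ?_)
  rintro x ⟨y, hxy⟩
  have hcont : ContinuousOn (fun s => S' (t - s) (S s x)) (Icc 0 t) := by
    intro s₀ hs₀
    have h1 : Tendsto (fun s => S' (t - s) (S s₀ x)) (𝓝[Icc 0 t] s₀)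
        (𝓝 (S' (t - s₀) (S s₀ x))) :=
      ((hS'.continuousOn_orbit (S s₀ x)).comp (f := fun s => t - s) (s := Icc 0 t)
        (by fun_prop) fun s hs => sub_nonneg.2 hs.2) s₀ hs₀
    have h2 : Tendsto (fun s => S' (t - s) (S s x - S s₀ x)) (𝓝[Icc 0 t] s₀) (𝓝 0) := by
      have h3 : Tendsto (fun s => M * ‖S s x - S s₀ x‖) (𝓝[Icc 0 t] s₀) (𝓝 0) := by
        have : Tendsto (fun s => S s x - S s₀ x) (𝓝[Icc 0 t] s₀) (𝓝 (S s₀ x - S s₀ x)) :=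
          (((hS.continuousOn_orbit x).mono Icc_subset_Ici_self) s₀ hs₀).sub_const _
        simpa using this.norm.const_mul M
      refine squeeze_zero_norm' ?_ h3
      filter_upwards [self_mem_nhdsWithin] with s hs
      exact (S' (t - s)).le_of_opNorm_le (hM _ ⟨sub_nonneg.2 hs.2, sub_le_self _ hs.1⟩) _
    have h4 := h2.add h1
    rw [zero_add] at h4
    refine h4.congr fun s => ?_
    rw [map_sub, sub_add_cancel]
  -- The difference quotient is `S'(t - s - r)` applied to the difference of the quotients of `S`
  -- and `S'` at `S(s)x`. Both quotients have the same limit, and the operators in front are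
  -- uniformly bounded.
  have hderiv : ∀ s ∈ Ico 0 t, HasDerivWithinAt (fun s => S' (t - s) (S s x)) 0 (Ici s) s := by
    intro s hs
    rw [hasDerivWithinAt_Ici_iff_tendsto]
    have hz := hxy.apply hS hs.1
    have h1 := (Tendsto.sub hz (h _ _ hz)).norm.const_mul M
    rw [sub_self, norm_zero, mul_zero] at h1
    refine squeeze_zero_norm' ?_ h1
    filter_upwards [Ioo_mem_nhdsGT (sub_pos.2 hs.2)] with r hr
    have hr0 : 0 ≤ r := hr.1.le
    have htr : 0 ≤ t - (s + r) := by linarith [hr.2]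
    have e1 : S' (t - s) (S s x) = S' (t - (s + r)) (S' r (S s x)) := by
      rw [← hS'.add_apply htr hr0]; congr 2; ring
    have e2 : r⁻¹ • (S' (t - (s + r)) (S (s + r) x) - S' (t - s) (S s x)) =
        S' (t - (s + r)) (r⁻¹ • (S r (S s x) - S s x) - r⁻¹ • (S' r (S s x) - S s x)) := by
      rw [e1, add_comm s r, hS.add_apply hr0 hs.1, ← map_sub, ← smul_sub]
      rw [RCLike.real_smul_eq_coe_smul (K := 𝕜), RCLike.real_smul_eq_coe_smul (K := 𝕜), map_smul]
      congr 2
      abel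
    rw [e2]
    exact (S' (t - (s + r))).le_of_opNorm_le (hM _ ⟨htr, by linarith [hs.1]⟩) _
  have := constant_of_has_deriv_right_zero hcont hderiv t (right_mem_Icc.2 ht)
  simpa [hS.zero_apply, hS'.zero_apply] using this.symm

/-- The rescaled family `e^{-λ t} T(t)`. -/
noncomputable def rescale (μ : ℝ) (T : ℝ → X →L[𝕜] X) (t : ℝ) : X →L[𝕜] X :=
  ((Real.exp (-μ * t) : ℝ) : 𝕜) • T t

theorem rescale_apply [IsScalarTower ℝ 𝕜 X] (μ : ℝ) (T : ℝ → X →L[𝕜] X) (t : ℝ) (x : X) :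
    rescale μ T t x = Real.exp (-μ * t) • T t x := by
  rw [RCLike.real_smul_eq_coe_smul (K := 𝕜)]; rfl

theorem rescale_neg_rescale [IsScalarTower ℝ 𝕜 X] (μ : ℝ) (T : ℝ → X →L[𝕜] X) :
    rescale (-μ) (rescale μ T) = T := by
  funext t
  ext x
  rw [rescale_apply, rescale_apply, smul_smul, ← Real.exp_add]
  simp

theorem norm_rescale_apply [IsScalarTower ℝ 𝕜 X] (μ : ℝ) (T : ℝ → X →L[𝕜] X) (t : ℝ) (x : X) :
    ‖rescale μ T t x‖ = Real.exp (-μ * t) * ‖T t x‖ := by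
  rw [rescale_apply, norm_smul, Real.norm_of_nonneg (Real.exp_pos _).le]

theorem IsC0Semigroup.rescale [IsScalarTower ℝ 𝕜 X] {T : ℝ → X →L[𝕜] X} (hT : IsC0Semigroup T)
    (μ : ℝ) : IsC0Semigroup (rescale μ T) where
  map_zero := by
    ext x
    simp [rescale_apply, hT.zero_apply]
  map_add s t hs ht := by
    ext x
    rw [ContinuousLinearMap.comp_apply, rescale_apply, rescale_apply, rescale_apply,
      RCLike.real_smul_eq_coe_smul (K := 𝕜) (Real.exp (-μ * t)), map_smul,
      ← RCLike.real_smul_eq_coe_smul (K := 𝕜), smul_smul, ← Real.exp_add, ← mul_add,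
      hT.add_apply hs ht]
  continuousOn_orbit x := by
    simp only [rescale_apply]
    exact ContinuousOn.smul (by fun_prop) (hT.continuousOn_orbit x)

theorem RightDeriv.rescale [IsScalarTower ℝ 𝕜 X] {T : ℝ → X →L[𝕜] X} (hT : IsC0Semigroup T)
    {x y : X} (h : RightDeriv T x y) (μ : ℝ) : RightDeriv (rescale μ T) x (y - μ • x) := by
  have h0 : HasDerivAt (fun r : ℝ => Real.exp (-μ * r)) (-μ) 0 := by
    have := ((hasDerivAt_id (0 : ℝ)).const_mul (-μ)).exp
    simpa using this
  have h1 := h0.tendsto_slope_zero_right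
  simp only [zero_add, mul_zero, Real.exp_zero] at h1
  have h2 := (h1.smul (hT.tendsto_zero x)).add h
  rw [neg_smul, neg_add_eq_sub] at h2
  refine h2.congr fun r => ?_
  rw [rescale_apply, smul_assoc, ← smul_add, sub_smul, one_smul]
  congr 1
  abel

theorem RightDeriv.of_rescale [IsScalarTower ℝ 𝕜 X] {T : ℝ → X →L[𝕜] X} (hT : IsC0Semigroup T)
    {x y : X} {μ : ℝ} (h : RightDeriv (UltraPerturb.rescale μ T) x y) :
    RightDeriv T x (y + μ • x) := by
  have := h.rescale (hT.rescale μ) (-μ)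
  rwa [rescale_neg_rescale, neg_smul, sub_neg_eq_add] at this

/-- Eigenvectors of the generator give exponential orbits. -/
theorem RightDeriv.rescale_apply_eq [IsScalarTower ℝ 𝕜 X] [CompleteSpace X] {T : ℝ → X →L[𝕜] X}
    (hT : IsC0Semigroup T) {x : X} {μ : ℝ} (h : RightDeriv T x (μ • x)) {t : ℝ} (ht : 0 ≤ t) :
    UltraPerturb.rescale μ T t x = x := by
  have h1 := h.rescale hT μ
  rw [sub_self] at h1
  have h2 := h1.integral_eq (hT.rescale μ) ht
  simp only [map_zero, intervalIntegral.integral_zero] at h2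
  exact (sub_eq_zero.1 h2.symm)

end Semigroup

/-! ### Perturbations bounded relative to the generator. -/

section RelativelyBounded

variable {𝕜 X : Type*} [RCLike 𝕜] [NormedAddCommGroup X] [NormedSpace 𝕜 X]

theorem total_of_mem {B : X →ₗ.[𝕜] X} {x : X} (h : x ∈ B.domain) : total B x = B ⟨x, h⟩ :=
  dif_pos h

theorem total_add {B : X →ₗ.[𝕜] X} {x y : X} (hx : x ∈ B.domain) (hy : y ∈ B.domain) :
    total B (x + y) = total B x + total B y := by
  rw [total_of_mem hx, total_of_mem hy, total_of_mem (B.domain.add_mem hx hy), ← B.map_add]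
  rfl

theorem total_smul {B : X →ₗ.[𝕜] X} (c : 𝕜) {x : X} (hx : x ∈ B.domain) :
    total B (c • x) = c • total B x := by
  rw [total_of_mem hx, total_of_mem (B.domain.smul_mem c hx), ← B.map_smul]
  rfl

theorem total_sub {B : X →ₗ.[𝕜] X} {x y : X} (hx : x ∈ B.domain) (hy : y ∈ B.domain) :
    total B (x - y) = total B x - total B y := by
  rw [total_of_mem hx, total_of_mem hy, total_of_mem (B.domain.sub_mem hx hy), ← B.map_sub]
  rfl

theorem total_real_smul [NormedSpace ℝ X] [IsScalarTower ℝ 𝕜 X] {B : X →ₗ.[𝕜] X} (c : ℝ) {x : X}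
    (hx : x ∈ B.domain) : total B (c • x) = c • total B x := by
  rw [RCLike.real_smul_eq_coe_smul (K := 𝕜), RCLike.real_smul_eq_coe_smul (K := 𝕜),
    total_smul _ hx]

variable [NormedSpace ℝ X]

/-- `B` is bounded with respect to the graph norm of the generator of `T`. -/
structure IsRelBounded (T : ℝ → X →L[𝕜] X) (B : X →ₗ.[𝕜] X) (K : ℝ) : Prop where
  dom : ∀ x y, RightDeriv T x y → x ∈ B.domain
  bound : ∀ x y, RightDeriv T x y → ‖total B x‖ ≤ K * (‖x‖ + ‖y‖)
  nonneg : 0 ≤ K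

variable {T : ℝ → X →L[𝕜] X} {B : X →ₗ.[𝕜] X} {K : ℝ}

theorem IsRelBounded.tendsto_total (hB : IsRelBounded T B K) {γ : Type*} {l : Filter γ}
    {f g : γ → X} {x y : X} (hfg : ∀ᶠ i in l, RightDeriv T (f i) (g i)) (hxy : RightDeriv T x y)
    (hf : Tendsto f l (𝓝 x)) (hg : Tendsto g l (𝓝 y)) :
    Tendsto (fun i => total B (f i)) l (𝓝 (total B x)) := by
  rw [tendsto_iff_norm_sub_tendsto_zero] at hf hg ⊢
  have h0 := (hf.add hg).const_mul K
  rw [add_zero, mul_zero] at h0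
  refine squeeze_zero' (Eventually.of_forall fun _ => norm_nonneg _) ?_ h0
  filter_upwards [hfg] with i hi
  rw [← total_sub (hB.dom _ _ hi) (hB.dom _ _ hxy)]
  exact hB.bound _ _ (hi.sub hxy)

variable [IsScalarTower ℝ 𝕜 X]

theorem IsRelBounded.rescale (hB : IsRelBounded T B K) (hT : IsC0Semigroup T) (μ : ℝ) :
    IsRelBounded (rescale μ T) B (K * (1 + |μ|)) where
  dom x y h := hB.dom x _ (h.of_rescale hT)
  bound x y h := by
    refine (hB.bound x _ (h.of_rescale hT)).trans ?_
    have h1 : ‖y + μ • x‖ ≤ ‖y‖ + |μ| * ‖x‖ := by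
      refine (norm_add_le _ _).trans ?_
      rw [norm_smul, Real.norm_eq_abs]
    rw [mul_assoc]
    refine mul_le_mul_of_nonneg_left ?_ hB.nonneg
    nlinarith [mul_nonneg (abs_nonneg μ) (norm_nonneg y)]
  nonneg := mul_nonneg hB.nonneg (by positivity)

theorem IsRelBounded.continuousOn_Ici (hB : IsRelBounded T B K) (hT : IsC0Semigroup T) {x y : X}
    (h : RightDeriv T x y) : ContinuousOn (fun s => total B (T s x)) (Ici 0) := by
  intro s₀ hs₀
  refine hB.tendsto_total (g := fun s => T s y) ?_ (h.apply hT hs₀)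
    (hT.continuousOn_orbit x s₀ hs₀) (hT.continuousOn_orbit y s₀ hs₀)
  filter_upwards [self_mem_nhdsWithin] with s hs
  exact h.apply hT hs

/-- Near `s₀ > 0` the orbit restarts from `T(s₀/2)x`, which lies in the domain of the generator. -/
theorem IsRelBounded.continuousOn_Ioi (hB : IsRelBounded T B K) (hT : IsC0Semigroup T)
    (hsm : ∀ s, 0 < s → ∀ x, ∃ y, RightDeriv T (T s x) y) (x : X) :
    ContinuousOn (fun s => total B (T s x)) (Ioi 0) := by
  intro s₀ hs₀
  have hs₀' : 0 < s₀ / 2 := half_pos hs₀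
  obtain ⟨y, hy⟩ := hsm _ hs₀' x
  have h1 : ContinuousAt (fun s => total B (T s (T (s₀ / 2) x))) (s₀ - s₀ / 2) :=
    (hB.continuousOn_Ici hT hy).continuousAt (Ici_mem_nhds (by linarith))
  have h2 : ContinuousAt (fun s => total B (T (s - s₀ / 2) (T (s₀ / 2) x))) s₀ :=
    ContinuousAt.comp (f := fun s => s - s₀ / 2) (x := s₀) h1 (by fun_prop)
  refine (h2.congr ?_).continuousWithinAt
  filter_upwards [Ioi_mem_nhds (show s₀ / 2 < s₀ by linarith [show 0 < s₀ from hs₀])] with s hs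
  rw [← hT.add_apply (sub_nonneg.2 (le_of_lt hs)) hs₀'.le, sub_add_cancel]

/-- `B` need not be closed, but it is bounded on the graph of the generator. By Hahn–Banach each
functional `l ∘ B` extends from the graph to `X × X`, where it commutes with the integral. -/
theorem RightDeriv.total_integral [CompleteSpace X] (hB : IsRelBounded T B K)
    (hT : IsC0Semigroup T) {x y : X} (h : RightDeriv T x y) {τ : ℝ} (hτ : 0 ≤ τ) :
    total B (∫ s in (0 : ℝ)..τ, T s x) = ∫ s in (0 : ℝ)..τ, total B (T s x) := by
  let G : Submodule 𝕜 (X × X) :=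
    { carrier := {p | RightDeriv T p.1 p.2}
      add_mem' := fun hp hp' => RightDeriv.add hp hp'
      zero_mem' := RightDeriv.zero
      smul_mem' := fun c p hp => RightDeriv.smul c hp }
  have hsub : uIcc 0 τ ⊆ Ici 0 := by rw [uIcc_of_le hτ]; exact Icc_subset_Ici_self
  have hBi : IntervalIntegrable (fun s => total B (T s x)) volume 0 τ :=
    ((hB.continuousOn_Ici hT h).mono hsub).intervalIntegrable
  refine (SeparatingDual.eq_iff_forall_dual_eq (R := 𝕜)).2 fun l => ?_
  let b : G →ₗ[𝕜] 𝕜 :=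
    { toFun := fun p => l (total B (p : X × X).1)
      map_add' := fun p p' => by
        rw [← map_add, ← total_add (hB.dom _ _ p.2) (hB.dom _ _ p'.2)]; rfl
      map_smul' := fun c p => by
        rw [RingHom.id_apply, ← map_smul, ← total_smul c (hB.dom _ _ p.2)]; rfl }
  obtain ⟨g, hg, -⟩ := exists_extension_norm_eq G (b.mkContinuous (‖l‖ * (K * 2)) (fun p => by
    refine (l.le_opNorm _).trans ?_
    rw [mul_assoc]
    refine mul_le_mul_of_nonneg_left ((hB.bound _ _ p.2).trans ?_) (norm_nonneg _)
    rw [mul_assoc]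
    refine mul_le_mul_of_nonneg_left ?_ hB.nonneg
    have h1 := norm_fst_le (p : X × X)
    have h2 := norm_snd_le (p : X × X)
    have h3 : ‖p‖ = ‖(p : X × X)‖ := rfl
    linarith))
  have hg' : ∀ u v, RightDeriv T u v → g (u, v) = l (total B u) := fun u v huv =>
    hg ⟨(u, v), huv⟩
  have hxi := hT.intervalIntegrable x le_rfl hτ
  have hyi := hT.intervalIntegrable y le_rfl hτ
  have hpair : IntervalIntegrable (fun s => (T s x, T s y)) volume 0 τ :=
    (((hT.continuousOn_orbit x).prodMk (hT.continuousOn_orbit y)).mono hsub).intervalIntegrable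
  have hint : ∫ s in (0 : ℝ)..τ, (T s x, T s y) = (∫ s in (0 : ℝ)..τ, T s x, T τ x - x) := by
    rw [← h.integral_eq hT hτ]
    simp only [intervalIntegral.integral_of_le hτ]
    exact integral_pair ((intervalIntegrable_iff_integrableOn_Ioc_of_le hτ).1 hxi)
      ((intervalIntegrable_iff_integrableOn_Ioc_of_le hτ).1 hyi)
  rw [← hg' _ _ (hT.rightDeriv_integral x hτ), ← hint, ← g.intervalIntegral_comp_comm hpair,
    ← l.intervalIntegral_comp_comm hBi]
  refine intervalIntegral.integral_congr fun s hs => ?_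
  exact hg' _ _ (h.apply hT (hsub hs))

/-- The Miyadera estimate extends from the domain of the generator to the whole space. -/
theorem IsRelBounded.miyadera [CompleteSpace X] (hB : IsRelBounded T B K) (hT : IsC0Semigroup T)
    (hsm : ∀ s, 0 < s → ∀ x, ∃ y, RightDeriv T (T s x) y) {q t₀ : ℝ} (ht₀ : 0 < t₀) (hq : 0 ≤ q)
    (hS2 : ∀ x y, RightDeriv T x y → (∫ s in (0 : ℝ)..t₀, ‖total B (T s x)‖) ≤ q * ‖x‖) (x : X) :
    IntervalIntegrable (fun s => total B (T s x)) volume 0 t₀ ∧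
      (∫ s in (0 : ℝ)..t₀, ‖total B (T s x)‖) ≤ q * ‖x‖ := by
  have hc := hB.continuousOn_Ioi hT hsm x
  have hii : ∀ a b, 0 < a → a ≤ b → IntervalIntegrable (fun s => total B (T s x)) volume a b := by
    intro a b ha hab
    refine (hc.mono ?_).intervalIntegrable
    rw [uIcc_of_le hab]
    exact fun s hs => ha.trans_le hs.1
  -- The hypothesis is applied to `T(h)x`, which lies in the domain; letting `h ↓ 0` afterwards
  -- gives integrability and the bound for arbitrary `x`.
  have hle : ∀ h ∈ Ioo 0 t₀, (∫ s in h..t₀, ‖total B (T s x)‖) ≤ q * ‖T h x‖ := by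
    intro h hh
    obtain ⟨y, hy⟩ := hsm h hh.1 x
    refine le_trans ?_ (hS2 _ _ hy)
    have h1 := intervalIntegral.integral_comp_add_right (a := 0) (b := t₀)
      (fun s => ‖total B (T s x)‖) h
    rw [zero_add] at h1
    have h2 : ∫ s in (0 : ℝ)..t₀, ‖total B (T s (T h x))‖ = ∫ s in h..t₀ + h, ‖total B (T s x)‖ := by
      rw [← h1]
      refine intervalIntegral.integral_congr fun s hs => ?_
      rw [uIcc_of_le ht₀.le] at hs
      simp only [hT.add_apply hs.1 hh.1.le]
    rw [h2, ← intervalIntegral.integral_add_adjacent_intervals (hii h t₀ hh.1 hh.2.le).norm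
      (hii t₀ (t₀ + h) ht₀ (by linarith [hh.1])).norm]
    have : 0 ≤ ∫ s in t₀..t₀ + h, ‖total B (T s x)‖ :=
      intervalIntegral.integral_nonneg (by linarith [hh.1]) fun s _ => norm_nonneg _
    linarith
  obtain ⟨M, -, hM⟩ := hT.exists_norm_le t₀
  have hev : ∀ᶠ h in 𝓝[>] (0 : ℝ), h ∈ Ioo 0 t₀ := Ioo_mem_nhdsGT ht₀
  have hint : IntegrableOn (fun s => total B (T s x)) (Ioc 0 t₀) := by
    have hmem : ∀ n : ℕ, t₀ / ((n : ℝ) + 2) ∈ Ioo 0 t₀ := fun n =>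
      ⟨by positivity, div_lt_self ht₀ (by linarith [n.cast_nonneg (α := ℝ)])⟩
    refine integrableOn_Ioc_of_intervalIntegral_norm_bounded_left (l := atTop)
      (a := fun n : ℕ => t₀ / ((n : ℝ) + 2)) (I := q * (M * ‖x‖)) (fun n => ?_) ?_ ?_
    · exact (intervalIntegrable_iff_integrableOn_Ioc_of_le (hmem n).2.le).1
        (hii _ _ (hmem n).1 (hmem n).2.le)
    · exact tendsto_const_nhds.div_atTop
        (tendsto_atTop_add_const_right _ _ tendsto_natCast_atTop_atTop)
    · refine Eventually.of_forall fun n => ?_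
      rw [← intervalIntegral.integral_of_le (hmem n).2.le]
      refine (hle _ (hmem n)).trans (mul_le_mul_of_nonneg_left ?_ hq)
      exact (T _).le_of_opNorm_le (hM _ ⟨(hmem n).1.le, (hmem n).2.le⟩) x
  have hint' := (intervalIntegrable_iff_integrableOn_Ioc_of_le ht₀.le).2 hint
  refine ⟨hint', ?_⟩
  have hcont := intervalIntegral.continuousOn_primitive_interval_left (a := 0) (b := t₀)
    (f := fun s => ‖total B (T s x)‖) (μ := volume) (by
      rw [uIcc_of_le ht₀.le, integrableOn_Icc_iff_integrableOn_Ioc]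
      exact hint.norm)
  have hl1 : Tendsto (fun h => ∫ s in h..t₀, ‖total B (T s x)‖) (𝓝[>] 0)
      (𝓝 (∫ s in (0 : ℝ)..t₀, ‖total B (T s x)‖)) := by
    refine (hcont 0 left_mem_uIcc).mono_left ?_
    rw [uIcc_of_le ht₀.le]
    exact nhdsWithin_le_of_mem (mem_of_superset (Ioo_mem_nhdsGT ht₀) Ioo_subset_Icc_self)
  refine le_of_tendsto_of_tendsto hl1 ((hT.tendsto_zero x).norm.const_mul q) ?_
  filter_upwards [hev] with h hh using hle h hh

end RelativelyBounded

/-! ### Global bounds after rescaling, and the range of `μ - A - B`. -/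

section Generation

variable {𝕜 X : Type*} [RCLike 𝕜] [NormedAddCommGroup X] [NormedSpace 𝕜 X] [NormedSpace ℝ X]
  [IsScalarTower ℝ 𝕜 X] {T : ℝ → X →L[𝕜] X} {B : X →ₗ.[𝕜] X} {K q q' t₀ μ : ℝ}

/-- The rescaled operator at time `t₀` is a contraction, so a bound on `[0, t₀]` propagates to all
times. -/
theorem isBoundedFamily_rescale [CompleteSpace X] (hT : IsC0Semigroup T) (ht₀ : 0 < t₀)
    (hμ0 : 0 ≤ μ) (hμ : Real.exp (-μ * t₀) * ‖T t₀‖ ≤ 1) :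
    ∃ M, 1 ≤ M ∧ IsBoundedFamily 𝕜 (fun t x => rescale μ T t x) M := by
  obtain ⟨M, hM1, hM⟩ := hT.exists_norm_le t₀
  have hM0 : 0 ≤ M := zero_le_one.trans hM1
  have key : ∀ n : ℕ, ∀ t, 0 ≤ t → t ≤ (n + 1 : ℕ) * t₀ → ∀ x, ‖rescale μ T t x‖ ≤ M * ‖x‖ := by
    intro n
    induction n with
    | zero =>
      intro t ht htn x
      rw [norm_rescale_apply]
      have h1 : Real.exp (-μ * t) ≤ 1 := Real.exp_le_one_iff.2 (by nlinarith)
      have h2 : ‖T t x‖ ≤ M * ‖x‖ := (T t).le_of_opNorm_le (hM t ⟨ht, by simpa using htn⟩) x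
      calc Real.exp (-μ * t) * ‖T t x‖ ≤ 1 * (M * ‖x‖) := by gcongr
        _ = M * ‖x‖ := one_mul _
    | succ n ih =>
      intro t ht htn x
      rcases le_total t ((n + 1 : ℕ) * t₀) with h | h
      · exact ih t ht h x
      · have hle : t₀ ≤ t := by
          refine le_trans ?_ h
          push_cast
          nlinarith [n.cast_nonneg (α := ℝ)]
        have h1 : rescale μ T t x = rescale μ T (t - t₀) (rescale μ T t₀ x) := by
          rw [← (hT.rescale μ).add_apply (sub_nonneg.2 hle) ht₀.le, sub_add_cancel]
        rw [h1]
        refine (ih _ (sub_nonneg.2 hle) ?_ _).trans ?_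
        · push_cast at htn ⊢
          linarith
        · refine mul_le_mul_of_nonneg_left ?_ hM0
          rw [norm_rescale_apply]
          calc Real.exp (-μ * t₀) * ‖T t₀ x‖ ≤ Real.exp (-μ * t₀) * (‖T t₀‖ * ‖x‖) := by
                gcongr
                exact (T t₀).le_opNorm x
            _ = (Real.exp (-μ * t₀) * ‖T t₀‖) * ‖x‖ := by ring
            _ ≤ 1 * ‖x‖ := by gcongr
            _ = ‖x‖ := one_mul _
  refine ⟨M, hM1, fun t _ => map_add _, fun t _ => map_smul _, fun t ht x => ?_,
    (hT.rescale μ).continuousOn_orbit⟩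
  obtain ⟨n, hn⟩ := exists_nat_ge (t / t₀)
  refine key n t ht ?_ x
  rw [div_le_iff₀ ht₀] at hn
  push_cast
  nlinarith

variable (hB : IsRelBounded T B K) (hT : IsC0Semigroup T)
  (hsm : ∀ s, 0 < s → ∀ x, ∃ y, RightDeriv T (T s x) y) (ht₀ : 0 < t₀)
  (hS2 : ∀ x, IntervalIntegrable (fun s => total B (T s x)) volume 0 t₀ ∧
      (∫ s in (0 : ℝ)..t₀, ‖total B (T s x)‖) ≤ q * ‖x‖)

theorem exists_rightDeriv_rescale (hT : IsC0Semigroup T)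
    (hsm : ∀ s, 0 < s → ∀ x, ∃ y, RightDeriv T (T s x) y) (μ : ℝ) {s : ℝ} (hs : 0 < s) (x : X) :
    ∃ y, RightDeriv (rescale μ T) (rescale μ T s x) y := by
  obtain ⟨y, hy⟩ := hsm s hs x
  exact ⟨_, (hy.smul ((Real.exp (-μ * s) : ℝ) : 𝕜)).rescale hT μ⟩

include hB hsm in
theorem total_rescale {s : ℝ} (hs : 0 < s) (x : X) :
    total B (rescale μ T s x) = Real.exp (-μ * s) • total B (T s x) := by
  obtain ⟨y, hy⟩ := hsm s hs x
  rw [rescale_apply, total_real_smul _ (hB.dom _ _ hy)]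

include hB hT hsm ht₀ hS2 in
-- Passing from `[0, n t₀]` to `[0, (n + 1) t₀]` replaces the constant `q'` by `q + e^{-μt₀}‖T(t₀)‖
-- q'`. The hypothesis on `μ` says that this is still at most `q'`.
theorem isIntegrableFamily_rescale (hμ0 : 0 ≤ μ) (hq' : 0 ≤ q')
    (hμ : Real.exp (-μ * t₀) * ‖T t₀‖ * q' ≤ q' - q) :
    IsIntegrableFamily 𝕜 (fun s x => total B (rescale μ T s x)) q' := by
  have hT' := hT.rescale μ
  have hB' := hB.rescale hT μ
  have hsm' := fun s (hs : 0 < s) x => exists_rightDeriv_rescale hT hsm μ hs x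
  have hcont := fun x => hB'.continuousOn_Ioi hT' hsm' x
  have hdom : ∀ s, 0 < s → ∀ x, rescale μ T s x ∈ B.domain := fun s hs x =>
    let ⟨_, hy⟩ := hsm' s hs x
    hB'.dom _ _ hy
  have hfirst : ∀ x, IntervalIntegrable (fun s => total B (rescale μ T s x)) volume 0 t₀ ∧
      (∫ s in (0 : ℝ)..t₀, ‖total B (rescale μ T s x)‖) ≤ q * ‖x‖ := by
    intro x
    obtain ⟨h1, h2⟩ := hS2 x
    have hle : ∀ s ∈ Ioc 0 t₀, ‖total B (rescale μ T s x)‖ ≤ ‖total B (T s x)‖ := by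
      intro s hs
      rw [total_rescale hB hsm hs.1, norm_smul, Real.norm_of_nonneg (Real.exp_pos _).le]
      exact mul_le_of_le_one_left (norm_nonneg _)
        (Real.exp_le_one_iff.2 (by nlinarith [hs.1]))
    have hint : IntegrableOn (fun s => total B (rescale μ T s x)) (Ioc 0 t₀) := by
      refine Integrable.mono ((intervalIntegrable_iff_integrableOn_Ioc_of_le ht₀.le).1 h1)
        (((hcont x).mono Ioc_subset_Ioi_self).aestronglyMeasurable measurableSet_Ioc) ?_
      filter_upwards [ae_restrict_mem measurableSet_Ioc] with s hs using hle s hs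
    refine ⟨(intervalIntegrable_iff_integrableOn_Ioc_of_le ht₀.le).2 hint, le_trans ?_ h2⟩
    rw [intervalIntegral.integral_of_le ht₀.le, intervalIntegral.integral_of_le ht₀.le]
    exact setIntegral_mono_on hint.norm
      ((intervalIntegrable_iff_integrableOn_Ioc_of_le ht₀.le).1 h1).norm measurableSet_Ioc hle
  have key : ∀ n : ℕ, ∀ x,
      IntervalIntegrable (fun s => total B (rescale μ T s x)) volume 0 (n * t₀) ∧
      (∫ s in (0 : ℝ)..n * t₀, ‖total B (rescale μ T s x)‖) ≤ q' * ‖x‖ := by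
    intro n
    induction n with
    | zero =>
      intro x
      simp only [Nat.cast_zero, zero_mul, intervalIntegral.integral_same]
      exact ⟨IntervalIntegrable.refl, by positivity⟩
    | succ n ih =>
      intro x
      have hn : ((n + 1 : ℕ) : ℝ) * t₀ = n * t₀ + t₀ := by push_cast; ring
      have hn0 : 0 ≤ (n : ℝ) * t₀ := by positivity
      have hi2 : IntervalIntegrable (fun s => total B (rescale μ T s x)) volume
          t₀ (n * t₀ + t₀) := by
        refine ((hcont x).mono ?_).intervalIntegrable
        rw [uIcc_of_le (by linarith)]
        exact fun s hs => ht₀.trans_le hs.1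
      rw [hn]
      refine ⟨(hfirst x).1.trans hi2, ?_⟩
      rw [← intervalIntegral.integral_add_adjacent_intervals (hfirst x).1.norm hi2.norm]
      have h1 := intervalIntegral.integral_comp_add_right (a := 0) (b := n * t₀)
        (fun s => ‖total B (rescale μ T s x)‖) t₀
      rw [zero_add] at h1
      have h2 : ∫ s in (0 : ℝ)..n * t₀, ‖total B (rescale μ T s (rescale μ T t₀ x))‖ =
          ∫ s in t₀..n * t₀ + t₀, ‖total B (rescale μ T s x)‖ := by
        rw [← h1]
        refine intervalIntegral.integral_congr fun s hs => ?_
        rw [uIcc_of_le hn0] at hs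
        simp only [hT'.add_apply hs.1 ht₀.le]
      rw [← h2]
      have h3 := (ih (rescale μ T t₀ x)).2
      have h4 : q' * ‖rescale μ T t₀ x‖ ≤ (q' - q) * ‖x‖ := by
        rw [norm_rescale_apply]
        calc q' * (Real.exp (-μ * t₀) * ‖T t₀ x‖)
            ≤ q' * (Real.exp (-μ * t₀) * (‖T t₀‖ * ‖x‖)) := by
              gcongr
              exact (T t₀).le_opNorm x
          _ = Real.exp (-μ * t₀) * ‖T t₀‖ * q' * ‖x‖ := by ring
          _ ≤ (q' - q) * ‖x‖ := by gcongr
      linarith [(hfirst x).2]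
  have htend : Tendsto (fun n : ℕ => (n : ℝ) * t₀) atTop atTop :=
    tendsto_natCast_atTop_atTop.atTop_mul_const ht₀
  have hint : ∀ x, IntegrableOn (fun s => total B (rescale μ T s x)) (Ioi 0) := fun x =>
    integrableOn_Ioi_of_intervalIntegral_norm_bounded (q' * ‖x‖) 0
      (fun n : ℕ => (intervalIntegrable_iff_integrableOn_Ioc_of_le (by positivity)).1 (key n x).1)
      htend (Eventually.of_forall fun n => (key n x).2)
  refine ⟨fun s hs x y => ?_, fun s hs a x => ?_, hcont, hint, fun x => ?_⟩
  · rw [map_add, total_add (hdom s hs x) (hdom s hs y)]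
  · rw [map_smul, total_smul a (hdom s hs x)]
  · exact le_of_tendsto' (intervalIntegral_tendsto_integral_Ioi 0 (hint x).norm htend)
      fun n => (key n x).2

include hB hT hsm ht₀ in
/-- If the Miyadera constant and the rescaled semigroup are small, then `μ - A - B` is
surjective. -/
theorem exists_rightDeriv_sub_eq [CompleteSpace X] (hq : 0 ≤ q)
    (hF : IsIntegrableFamily 𝕜 (fun s x => total B (rescale μ T s x)) q)
    (hμ : Real.exp (-μ * t₀) * ‖T t₀‖ + q < 1) (y : X) :
    ∃ z a, RightDeriv T z a ∧ μ • z - a - total B z = y := by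
  have hT' := hT.rescale μ
  have hB' := hB.rescale hT μ
  have hFi : ∀ x, IntervalIntegrable (fun s => total B (rescale μ T s x)) volume 0 t₀ := fun x =>
    (intervalIntegrable_iff_integrableOn_Ioc_of_le ht₀.le).2
      ((hF.integrable x).mono_set Ioc_subset_Ioi_self)
  have hIle : ∀ x, ‖∫ s in (0 : ℝ)..t₀, total B (rescale μ T s x)‖ ≤ q * ‖x‖ := by
    intro x
    rw [intervalIntegral.integral_of_le ht₀.le]
    refine (norm_integral_le_integral_norm _).trans ?_
    refine (setIntegral_mono_set (hF.integrable x).norm ?_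
      Ioc_subset_Ioi_self.eventuallyLE).trans (hF.integral_le x)
    exact Eventually.of_forall fun s => norm_nonneg _
  let J₀ : X →ₗ[𝕜] X :=
    { toFun := fun x => ∫ s in (0 : ℝ)..t₀, total B (rescale μ T s x)
      map_add' := fun x x' => by
        rw [← intervalIntegral.integral_add (hFi x) (hFi x')]
        refine intervalIntegral.integral_congr_ae (Eventually.of_forall fun s hs => ?_)
        rw [uIoc_of_le ht₀.le] at hs
        exact hF.add s hs.1 x x'
      map_smul' := fun c x => by
        rw [RingHom.id_apply, ← intervalIntegral.integral_smul]
        refine intervalIntegral.integral_congr_ae (Eventually.of_forall fun s hs => ?_)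
        rw [uIoc_of_le ht₀.le] at hs
        exact hF.smul s hs.1 c x }
  -- For the truncated resolvent integral `z = ∫₀^{t₀} R(s) w ds`, with `R` the rescaled semigroup,
  -- `(μ - A - B) z = (1 - R(t₀) - J) w`. The operator on the right is inverted by a Neumann series.
  let J : X →L[𝕜] X := J₀.mkContinuous q hIle
  have hJ : ∀ x, J x = ∫ s in (0 : ℝ)..t₀, total B (rescale μ T s x) := fun x => rfl
  have hJn : ‖J‖ ≤ q := LinearMap.mkContinuous_norm_le _ hq _
  have hRn : ‖rescale μ T t₀‖ ≤ Real.exp (-μ * t₀) * ‖T t₀‖ := by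
    refine ContinuousLinearMap.opNorm_le_bound _ (by positivity) fun x => ?_
    rw [norm_rescale_apply, mul_assoc]
    gcongr
    exact (T t₀).le_opNorm x
  have hunit : IsUnit (1 - (rescale μ T t₀ + J)) := isUnit_one_sub_of_norm_lt_one
    (((norm_add_le _ _).trans (add_le_add hRn hJn)).trans_lt hμ)
  obtain ⟨w, hw⟩ : ∃ w, (1 - (rescale μ T t₀ + J)) w = y := by
    obtain ⟨u, hu⟩ := hunit
    refine ⟨(↑u⁻¹ : X →L[𝕜] X) y, ?_⟩
    rw [← hu, ← mul_apply_eq_comp, Units.mul_inv, one_apply_eq_self]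
  have hz := hT'.rightDeriv_integral w ht₀.le
  set z := ∫ s in (0 : ℝ)..t₀, rescale μ T s w with hzdef
  have hBz : total B z = J w := by
    -- `w` itself need not lie in the domain, so `B` is interchanged with the integral for `R(h)w`
    -- and then `h ↓ 0`.
    have hR : ∀ h, 0 < h → total B (rescale μ T h z) = J (rescale μ T h w) := by
      intro h hh
      obtain ⟨v, hv⟩ := exists_rightDeriv_rescale hT hsm μ hh w
      rw [hJ, ← hv.total_integral hB' hT' ht₀.le, hzdef,
        ← (rescale μ T h).intervalIntegral_comp_comm (hT'.intervalIntegrable w le_rfl ht₀.le)]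
      congr 1
      refine intervalIntegral.integral_congr fun s hs => ?_
      rw [uIcc_of_le ht₀.le] at hs
      simp only [← hT'.add_apply hs.1 hh.le, ← hT'.add_apply hh.le hs.1, add_comm s h]
    have h1 : Tendsto (fun h => total B (rescale μ T h z)) (𝓝[>] 0) (𝓝 (total B z)) := by
      refine hB'.tendsto_total (g := fun h => rescale μ T h (rescale μ T t₀ w - w)) ?_ hz
        (hT'.tendsto_zero _) (hT'.tendsto_zero _)
      filter_upwards [self_mem_nhdsWithin] with h hh
      exact hz.apply hT' (le_of_lt hh)
    have h2 : Tendsto (fun h => J (rescale μ T h w)) (𝓝[>] 0) (𝓝 (J w)) :=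
      (J.continuous.tendsto w).comp (hT'.tendsto_zero w)
    refine tendsto_nhds_unique h1 (h2.congr' ?_)
    filter_upwards [self_mem_nhdsWithin] with h hh
    exact (hR h hh).symm
  refine ⟨z, _, hz.of_rescale hT, ?_⟩
  rw [hBz, ← hw]
  simp only [sub_apply, one_apply_eq_self,
    add_apply]
  abel

end Generation

/-! ### The choice of `μ` and the perturbed semigroup. -/

section Perturbation

variable {𝕜 X : Type*} [RCLike 𝕜] [NormedAddCommGroup X] [NormedSpace 𝕜 X]

theorem mem_graph_add_iff {A B : X →ₗ.[𝕜] X} (hAB : A.domain ≤ B.domain) {x y : X} :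
    (x, y) ∈ (A + B).graph ↔ ∃ a, (x, a) ∈ A.graph ∧ y = a + total B x := by
  simp only [LinearPMap.mem_graph_iff]
  constructor
  · rintro ⟨u, hu, huy⟩
    have hA : (u : X) ∈ A.domain := u.2.1
    refine ⟨A ⟨u, hA⟩, ⟨⟨u, hA⟩, hu, rfl⟩, ?_⟩
    have hu' : (u : X) = x := hu
    rw [← hu', total_of_mem (hAB hA)]
    exact huy.symm
  · rintro ⟨a, ⟨u, hu, hua⟩, rfl⟩
    have hu' : (u : X) = x := hu
    refine ⟨⟨u, u.2, hAB u.2⟩, hu, ?_⟩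
    rw [← hu', total_of_mem (hAB u.2)]
    have hua' : A u = a := hua
    rw [← hua']
    rfl

theorem exists_rescaling {q t₀ β : ℝ} (hq1 : q < 1) (ht₀ : 0 < t₀) (hβ : β < 1) (c C : ℝ) :
    ∃ μ : ℝ, 0 ≤ μ ∧ Real.exp (-μ * t₀) * c ≤ (1 - q) / 4 ∧
      ∫ s in Ioo (0 : ℝ) 1, Real.exp (-μ * s) * (C * s ^ (-β)) ≤ 1 / 2 := by
  have hexp : ∀ s : ℝ, 0 < s → Tendsto (fun μ : ℝ => Real.exp (-μ * s)) atTop (𝓝 0) := by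
    intro s hs
    refine Real.tendsto_exp_atBot.comp ?_
    exact tendsto_neg_atTop_atBot.atBot_mul_const hs
  have h1 : Tendsto (fun μ : ℝ => Real.exp (-μ * t₀) * c) atTop (𝓝 0) := by
    simpa using (hexp t₀ ht₀).mul_const c
  have hi : IntegrableOn (fun s : ℝ => C * s ^ (-β)) (Ioo 0 1) :=
    ((intervalIntegral.integrableOn_Ioo_rpow_iff one_pos).2 (by linarith)).const_mul _
  have h2 : Tendsto (fun μ : ℝ => ∫ s in Ioo (0 : ℝ) 1, Real.exp (-μ * s) * (C * s ^ (-β))) atTop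
      (𝓝 (∫ _ in Ioo (0 : ℝ) 1, (0 : ℝ))) := by
    refine tendsto_integral_filter_of_dominated_convergence (fun s => ‖C * s ^ (-β)‖) ?_ ?_
      hi.norm ?_
    · refine Eventually.of_forall fun μ => ?_
      exact (Continuous.aestronglyMeasurable (by fun_prop)).mul hi.aestronglyMeasurable
    · filter_upwards [eventually_ge_atTop 0] with μ hμ
      filter_upwards [ae_restrict_mem measurableSet_Ioo] with s hs
      rw [norm_mul, Real.norm_of_nonneg (Real.exp_pos _).le]
      exact mul_le_of_le_one_left (norm_nonneg _)
        (Real.exp_le_one_iff.2 (by nlinarith [hs.1]))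
    · filter_upwards [ae_restrict_mem measurableSet_Ioo] with s hs
      simpa using (hexp s hs.1).mul_const (C * s ^ (-β))
  rw [integral_zero] at h2
  obtain ⟨μ, h, h', h''⟩ := ((eventually_ge_atTop 0).and
    ((h1.eventually (ge_mem_nhds (show 0 < (1 - q) / 4 by linarith))).and
      (h2.eventually (ge_mem_nhds (show (0 : ℝ) < 1 / 2 by norm_num))))).exists
  exact ⟨μ, h, h', h''⟩

variable [NormedSpace ℝ X] [IsScalarTower ℝ 𝕜 X] [CompleteSpace X]
  {T : ℝ → X →L[𝕜] X} {B : X →ₗ.[𝕜] X} {K q t₀ μ : ℝ}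

/-- The Miyadera–Voigt perturbation theorem for semigroups with orbits in the domain of the
generator; the perturbed semigroup is the sum of the rescaled Dyson–Phillips series. -/
theorem exists_perturbed_semigroup (hB : IsRelBounded T B K) (hT : IsC0Semigroup T)
    (hsm : ∀ s, 0 < s → ∀ x, ∃ y, RightDeriv T (T s x) y) (ht₀ : 0 < t₀)
    (hq0 : 0 ≤ q) (hq1 : q < 1)
    (hS2 : ∀ x, IntervalIntegrable (fun s => total B (T s x)) volume 0 t₀ ∧
      (∫ s in (0 : ℝ)..t₀, ‖total B (T s x)‖) ≤ q * ‖x‖)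
    (hμ0 : 0 ≤ μ) (hμ : Real.exp (-μ * t₀) * ‖T t₀‖ ≤ (1 - q) / 4) :
    ∃ S : ℝ → X →L[𝕜] X, IsC0Semigroup S ∧
      (∀ x y, RightDeriv S x y ↔ ∃ a, RightDeriv T x a ∧ y = a + total B x) ∧
      ∀ t, 0 ≤ t → ∀ x, S t x = Real.exp (μ * t) •
        dysonSum (fun t x => rescale μ T t x) (fun s x => total B (rescale μ T s x)) t x := by
  have hT' := hT.rescale μ
  have hB' := hB.rescale hT μ
  obtain ⟨M, hM1, hTM⟩ := isBoundedFamily_rescale hT ht₀ hμ0 (hμ.trans (by linarith))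
  have hM0 : 0 ≤ M := zero_le_one.trans hM1
  -- Raising the Miyadera constant from `q` to `(1 + q)/2` pays for passing from `[0, t₀]` to the
  -- half-line.
  have hq'0 : 0 ≤ (1 + q) / 2 := by linarith
  have hq'1 : (1 + q) / 2 < 1 := by linarith
  have hmul : ∀ r, Real.exp (-r * t₀) * ‖T t₀‖ ≤ (1 - q) / 4 →
      Real.exp (-r * t₀) * ‖T t₀‖ * ((1 + q) / 2) ≤ (1 + q) / 2 - q := by
    intro r hr
    have h0 : 0 ≤ Real.exp (-r * t₀) * ‖T t₀‖ := by positivity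
    nlinarith
  have hF := isIntegrableFamily_rescale hB hT hsm ht₀ hS2 hμ0 hq'0 (hmul μ hμ)
  have hU := IsBoundedFamily.dysonSum hM0 hTM hF hq'0 hq'1
  have hUeq := fun {t} (ht : 0 ≤ t) x => dysonSum_eq (t := t) hM0 hTM hF hq'0 hq'1 ht x
  have hUadd := fun {r t} (hr : 0 ≤ r) (ht : 0 ≤ t) x =>
    dysonSum_add (r := r) (t := t) hM0 hTM hF hq'0 hq'1
      (fun s t hs ht x => hT'.add_apply hs ht x)
      (fun s t hs ht x => by rw [hT'.add_apply hs.le ht]) hr ht x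
  set U := dysonSum (fun t x => rescale μ T t x) (fun s x => total B (rescale μ T s x)) with hUdef
  set c := M * (1 - (1 + q) / 2)⁻¹ with hc
  have hc0 : 0 ≤ c := mul_nonneg hM0 (inv_nonneg.2 (by linarith))
  have hU0 : ∀ x, U 0 x = x := by
    intro x
    rw [hUeq le_rfl, conv, Ioo_self, setIntegral_empty, add_zero, hT'.zero_apply]
  obtain ⟨L, hL⟩ := hU.exists_clm
  have hLsg : IsC0Semigroup L := by
    refine ⟨?_, fun s t hs ht => ?_, fun x => ?_⟩
    · ext x
      rw [hL 0 le_rfl, hU0]; rfl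
    · ext x
      rw [hL _ (add_nonneg hs ht), hUadd hs ht, ContinuousLinearMap.comp_apply, hL s hs, hL t ht]
    · exact (hU.cont x).congr fun t ht => hL t ht x
  have hLderiv : ∀ x a, RightDeriv (rescale μ T) x a → RightDeriv L x (a + total B x) := by
    intro x a hxa
    have hb : Tendsto (fun s => total B (rescale μ T s x)) (𝓝[>] 0) (𝓝 (total B x)) := by
      have := (hB'.continuousOn_Ici hT' hxa 0 self_mem_Ici).mono Ioi_subset_Ici_self
      rwa [ContinuousWithinAt, hT'.zero_apply] at this
    have h1 := tendsto_inv_smul_conv hc0 hU hF (hU0 _) hb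
    refine (Tendsto.add hxa h1).congr' ?_
    filter_upwards [self_mem_nhdsWithin] with h hh
    rw [hL h (le_of_lt hh), hUeq (le_of_lt hh), ← smul_add]
    congr 1
    abel
  have hSsg : IsC0Semigroup (rescale (-μ) L) := hLsg.rescale (-μ)
  have hLS : rescale μ (rescale (-μ) L) = L := by
    have := rescale_neg_rescale (-μ) L
    rwa [neg_neg] at this
  have hSderiv : ∀ x a, RightDeriv T x a → RightDeriv (rescale (-μ) L) x (a + total B x) := by
    intro x a hxa
    have h1 := (hLderiv x _ (hxa.rescale hT μ)).rescale hLsg (-μ)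
    convert h1 using 1
    rw [neg_smul]
    abel
  refine ⟨rescale (-μ) L, hSsg, fun x y => ⟨fun hxy => ?_, ?_⟩, fun t ht x => ?_⟩
  -- Surjectivity is used at `μ + 1` because the new semigroup is only known to be `O(e^{μt})`: an
  -- eigenvector for `μ + 1` would grow too fast, one for `μ` need not.
  · have hν : Real.exp (-(μ + 1) * t₀) * ‖T t₀‖ ≤ (1 - q) / 4 := by
      refine le_trans ?_ hμ
      gcongr
      linarith
    have hFν := isIntegrableFamily_rescale hB hT hsm ht₀ hS2 (by linarith) hq'0 (hmul (μ + 1) hν)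
    obtain ⟨z, a, hza, hz⟩ := exists_rightDeriv_sub_eq hB hT hsm ht₀ hq'0 hFν (by linarith)
      ((μ + 1) • x - y)
    have hd := hxy.sub (hSderiv z a hza)
    have heig : y - (a + total B z) = (μ + 1) • (x - z) := by
      rw [smul_sub]
      have : a + total B z = (μ + 1) • z - ((μ + 1) • x - y) := by rw [← hz]; abel
      rw [this]
      abel
    rw [heig] at hd
    have hxz : x - z = 0 := by
      have hfix : ∀ t, 0 ≤ t → ‖x - z‖ ≤ Real.exp (-1 * t) * (c * ‖x - z‖) := by
        intro t ht
        have h1 := hd.rescale_apply_eq hSsg ht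
        have h2 : rescale (μ + 1) (rescale (-μ) L) t (x - z) = Real.exp (-1 * t) • L t (x - z) := by
          rw [rescale_apply, rescale_apply, smul_smul, ← Real.exp_add]
          congr 2
          ring
        rw [h2] at h1
        calc ‖x - z‖ = ‖Real.exp (-1 * t) • L t (x - z)‖ := by rw [h1]
          _ = Real.exp (-1 * t) * ‖L t (x - z)‖ := by
            rw [norm_smul, Real.norm_of_nonneg (Real.exp_pos _).le]
          _ ≤ _ := by
            gcongr
            rw [hL t ht]
            exact hU.bound t ht _
      have hlim : Tendsto (fun t : ℝ => Real.exp (-1 * t) * (c * ‖x - z‖)) atTop (𝓝 0) := by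
        have h0 : Tendsto (fun t : ℝ => Real.exp (-1 * t)) atTop (𝓝 0) := by
          simpa using Real.tendsto_exp_neg_atTop_nhds_zero
        simpa using h0.mul_const (c * ‖x - z‖)
      refine norm_le_zero_iff.1 (ge_of_tendsto hlim ?_)
      filter_upwards [eventually_ge_atTop 0] with t ht using hfix t ht
    rw [hxz, smul_zero] at heig
    rw [sub_eq_zero.1 hxz]
    exact ⟨a, hza, sub_eq_zero.1 heig⟩
  · rintro ⟨a, hxa, rfl⟩
    exact hSderiv x a hxa
  · rw [rescale_apply, hL t ht, neg_neg]

end Perturbation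

end UltraPerturb

/-! ### Generation and the estimate from `X` into `V`. -/

theorem mainTheorem2 {𝕜 X V : Type*} [RCLike 𝕜]
    [NormedAddCommGroup X] [NormedSpace 𝕜 X] [CompleteSpace X]
    [NormedAddCommGroup V] [NormedSpace 𝕜 V] [CompleteSpace V]
    -- the `C₀`-semigroup `T` on `X` and its generator `A`
    (T : ℝ → X →L[𝕜] X) (hT : UltraPerturb.IsC0Semigroup T)
    (A : X →ₗ.[𝕜] X) (hA : UltraPerturb.IsGenerator T A)
    -- the continuous embedding of `V` into `X`
    (ι : V →L[𝕜] X) (hι : Function.Injective ι)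
    -- the operator `B`, with `dom A ⊆ dom B`, bounded on `dom A` for the graph norm
    (B : X →ₗ.[𝕜] X) (hAB : A.domain ≤ B.domain)
    (hB : ∃ K : ℝ, ∀ x : A.domain,
      ‖B ⟨x, hAB x.2⟩‖ ≤ K * (‖(x : X)‖ + ‖A x‖))
    (C α β q t₀ : ℝ) (hC : 1 ≤ C) (hα : 0 < α) (hβ : β ∈ Set.Ico (0 : ℝ) 1)
    (hq : q ∈ Set.Ioo (0 : ℝ) 1) (ht₀ : 0 < t₀)
    -- (S1)
    (hS1 : ∀ t ∈ Set.Ioc (0 : ℝ) 1, UltraPerturb.BoundedInto ι (T t) (C * t ^ (-α)))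
    -- (S2)
    (hS2 : ∀ x ∈ A.domain, (∫ s in (0 : ℝ)..t₀, ‖UltraPerturb.total B (T s x)‖) ≤ q * ‖x‖)
    -- (S3)
    (hS3 : ∀ t ∈ Set.Ioc (0 : ℝ) 1, UltraPerturb.BoundedInto ι (T t ∘L ι) C)
    (hS3' : ∀ t ∈ Set.Ioc (0 : ℝ) 1, ∀ x : V, ∀ h : T t (ι x) ∈ B.domain,
      ∃ v : V, ι v = B ⟨T t (ι x), h⟩ ∧ ‖v‖ ≤ C * t ^ (-β) * ‖x‖)
    -- `V` is separable, or its closed unit ball is closed in `X`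
    (hV : TopologicalSpace.SeparableSpace V ∨ IsClosed (ι '' Metric.closedBall (0 : V) 1))
    (hdiff : UltraPerturb.ImmediatelyDifferentiable T) :
    (∃ S : ℝ → X →L[𝕜] X,
      UltraPerturb.IsC0Semigroup S ∧ UltraPerturb.IsGenerator S (A + B)) ∧
    ∀ S : ℝ → X →L[𝕜] X,
      UltraPerturb.IsC0Semigroup S → UltraPerturb.IsGenerator S (A + B) →
        ∃ C' : ℝ, 0 < C' ∧
          ∀ t ∈ Set.Ioc (0 : ℝ) 1, UltraPerturb.BoundedInto ι (S t) (C' * t ^ (-α)) := by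
  let _ : NormedSpace ℝ X := NormedSpace.restrictScalars ℝ 𝕜 X
  let _ : NormedSpace ℝ V := NormedSpace.restrictScalars ℝ 𝕜 V
  have : IsScalarTower ℝ 𝕜 X := ⟨fun r a x => by
    change (r • a) • x = (algebraMap ℝ 𝕜 r) • (a • x)
    rw [Algebra.smul_def, mul_smul]⟩
  have hA' := UltraPerturb.isGenerator_iff.1 hA
  obtain ⟨K, hK⟩ := hB
  have hRel : UltraPerturb.IsRelBounded T B (max K 0) := by
    have hdom : ∀ x y, UltraPerturb.RightDeriv T x y → ∃ h : x ∈ A.domain, A ⟨x, h⟩ = y := by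
      intro x y h
      obtain ⟨u, hu, huy⟩ := A.mem_graph_iff.1 ((hA' x y).2 h)
      have hu' : (u : X) = x := hu
      subst hu'
      exact ⟨u.2, huy⟩
    refine ⟨fun x y h => hAB (hdom x y h).1, fun x y h => ?_, le_max_right _ _⟩
    obtain ⟨hx, rfl⟩ := hdom x y h
    rw [UltraPerturb.total_of_mem (hAB hx)]
    exact (hK ⟨x, hx⟩).trans (by gcongr; exact le_max_left _ _)
  have hsm : ∀ s, 0 < s → ∀ x, ∃ y, UltraPerturb.RightDeriv T (T s x) y := by
    intro s hs x
    have hd : DifferentiableAt ℝ (fun t => T t x) s :=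
      (hdiff x s hs).differentiableAt (Ioi_mem_nhds hs)
    refine ⟨_, (hd.hasDerivAt.tendsto_slope_zero_right).congr' ?_⟩
    filter_upwards [self_mem_nhdsWithin] with h hh
    rw [add_comm s h, hT.add_apply (le_of_lt hh) hs.le]
  have hS2' : ∀ x, _ ∧ _ := hRel.miyadera hT hsm ht₀ hq.1.le (fun x y h => hS2 x (by
    obtain ⟨u, hu, -⟩ := A.mem_graph_iff.1 ((hA' x y).2 h)
    have hu' : (u : X) = x := hu
    exact hu' ▸ u.2))
  obtain ⟨μ, hμ0, hμ, hμβ⟩ := UltraPerturb.exists_rescaling hq.2 ht₀ hβ.2 ‖T t₀‖ C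
  obtain ⟨S, hS, hSgen, hSeq⟩ := UltraPerturb.exists_perturbed_semigroup hRel hT hsm ht₀ hq.1.le
    hq.2 hS2' hμ0 hμ
  have hSA : UltraPerturb.IsGenerator S (A + B) := by
    refine UltraPerturb.isGenerator_iff.2 fun x y => ?_
    rw [UltraPerturb.mem_graph_add_iff hAB, hSgen]
    simp only [hA']
  refine ⟨⟨S, hS, hSA⟩, fun S' hS' hS'A => ?_⟩
  have hSA' := UltraPerturb.isGenerator_iff.1 hSA
  have hS'A' := UltraPerturb.isGenerator_iff.1 hS'A
  -- The domain of `A + B` contains `T(h)x` for all `h > 0`, and `T(h)x → x`. Density makes `S` the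
  -- only semigroup generated by `A + B`, so the estimate need only be proved for the series.
  have hdense : Dense {x | ∃ y, UltraPerturb.RightDeriv S x y} := by
    intro x
    refine mem_closure_of_tendsto (hT.tendsto_zero x) ?_
    filter_upwards [self_mem_nhdsWithin] with h hh
    obtain ⟨a, ha⟩ := hsm h hh x
    exact ⟨_, (hSgen _ _).2 ⟨a, ha, rfl⟩⟩
  have hSS' : ∀ t, 0 ≤ t → S' t = S t := fun t ht =>
    hS.eq_of_rightDeriv hS' (fun x y h => (hS'A' x y).1 ((hSA' x y).2 h)) hdense ht
  have hC0 : 0 ≤ C := zero_le_one.trans hC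
  have hexp : ∀ t, 0 < t → Real.exp (-μ * t) ≤ 1 := fun t ht =>
    Real.exp_le_one_iff.2 (by nlinarith)
  have hreal : ∀ (r : ℝ) (v : V), ι ((r : 𝕜) • v) = r • ι v := fun r v => by
    rw [map_smul, RCLike.real_smul_eq_coe_smul (K := 𝕜)]
  have hnorm : ∀ (t : ℝ) (v : V), ‖((Real.exp (-μ * t) : ℝ) : 𝕜) • v‖ =
      Real.exp (-μ * t) * ‖v‖ := fun t v => by
    rw [norm_smul, RCLike.norm_ofReal, abs_of_pos (Real.exp_pos _)]
  obtain ⟨M, hM1, hTM⟩ := UltraPerturb.isBoundedFamily_rescale hT ht₀ hμ0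
    (hμ.trans (by linarith [hq.1]))
  have hF := UltraPerturb.isIntegrableFamily_rescale (q' := (1 + q) / 2) hRel hT hsm ht₀ hS2' hμ0
    (by linarith [hq.1]) (by
      have h0 : 0 ≤ Real.exp (-μ * t₀) * ‖T t₀‖ := by positivity
      nlinarith [hq.1, hq.2])
  obtain ⟨C', hC'0, hC'⟩ := UltraPerturb.exists_preimage_dysonSum (ι := ι) hι hV
    (T := fun t x => UltraPerturb.rescale μ T t x)
    (F := fun s x => UltraPerturb.total B (UltraPerturb.rescale μ T s x))
    (q := (1 + q) / 2) (C := C) (α := α) (β := β) (ρ := 1 / 2)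
    (k := fun s => Real.exp (-μ * s) * (C * s ^ (-β)))
    (zero_le_one.trans hM1) hTM hF (by linarith [hq.1]) (by linarith [hq.2]) hC0
    (by
      intro t ht v
      obtain ⟨L, hL, hLn⟩ := hS3 t ht
      refine ⟨((Real.exp (-μ * t) : ℝ) : 𝕜) • L v, ?_, ?_⟩
      · rw [hreal, UltraPerturb.rescale_apply]
        exact congrArg (Real.exp (-μ * t) • ·) (DFunLike.congr_fun hL v)
      · rw [hnorm]
        exact (mul_le_of_le_one_left (norm_nonneg _) (hexp t ht.1)).trans (L.le_of_opNorm_le hLn v))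
    (by
      intro t ht v
      obtain ⟨y, hy⟩ := hsm t ht.1 (ι v)
      obtain ⟨w, hw, hwn⟩ := hS3' t ht v (hRel.dom _ _ hy)
      refine ⟨((Real.exp (-μ * t) : ℝ) : 𝕜) • w, ?_, ?_⟩
      · rw [hreal, UltraPerturb.total_rescale hRel hsm ht.1, hw,
          UltraPerturb.total_of_mem (hRel.dom _ _ hy)]
      · rw [hnorm, mul_assoc]
        gcongr)
    (by
      have hi : MeasureTheory.IntegrableOn (fun s : ℝ => C * s ^ (-β)) (Ioo 0 1) :=
        ((intervalIntegral.integrableOn_Ioo_rpow_iff one_pos).2 (by linarith [hβ.2])).const_mul _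
      refine MeasureTheory.Integrable.mono hi ((Continuous.aestronglyMeasurable (by fun_prop)).mul
        hi.aestronglyMeasurable) ?_
      filter_upwards [MeasureTheory.ae_restrict_mem measurableSet_Ioo] with s hs
      rw [norm_mul, Real.norm_of_nonneg (Real.exp_pos _).le]
      exact mul_le_of_le_one_left (norm_nonneg _) (hexp s hs.1))
    (fun t ht => by have := Real.rpow_nonneg ht.1.le (-β); positivity)
    hμβ (by norm_num) (by norm_num) hα hβ.2
    (by
      intro t ht x
      obtain ⟨L, hL, hLn⟩ := hS1 t ht
      refine ⟨((Real.exp (-μ * t) : ℝ) : 𝕜) • L x, ?_, ?_⟩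
      · rw [hreal, UltraPerturb.rescale_apply]
        exact congrArg (Real.exp (-μ * t) • ·) (DFunLike.congr_fun hL x)
      · rw [hnorm]
        exact (mul_le_of_le_one_left (norm_nonneg _) (hexp t ht.1)).trans (L.le_of_opNorm_le hLn x))
    (fun t ht => mul_le_of_le_one_left
      (by have := Real.rpow_nonneg ht.1.le (-β); positivity) (hexp t ht.1))
    (fun s t hs ht x => by rw [(hT.rescale μ).add_apply hs.le ht])
  -- The factor `e^μ` undoes the rescaling on `(0, 1]`.
  refine ⟨Real.exp μ * C', by positivity, fun t ht => ?_⟩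
  rw [hSS' t ht.1.le]
  have hbound : ∀ x, ∃ w : V, ι w = S t x ∧ ‖w‖ ≤ Real.exp μ * C' * t ^ (-α) * ‖x‖ := by
    intro x
    obtain ⟨w, hw, hwn⟩ := hC' t ht x
    refine ⟨((Real.exp (μ * t) : ℝ) : 𝕜) • w, ?_, ?_⟩
    · rw [hreal, hw, hSeq t ht.1.le]
    · rw [norm_smul, RCLike.norm_ofReal, abs_of_pos (Real.exp_pos _), mul_assoc, mul_assoc,
        ← mul_assoc C']
      gcongr
      nlinarith [ht.2]
  choose w hw hwn using hbound
  have hpos : 0 ≤ Real.exp μ * C' * t ^ (-α) := by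
    have := Real.rpow_nonneg ht.1.le (-α)
    positivity
  -- The pointwise preimages depend linearly on `x` because `ι` is injective.
  let W : X →ₗ[𝕜] V :=
    { toFun := w
      map_add' := fun x y => hι (by rw [hw, map_add, map_add, hw, hw])
      map_smul' := fun c x => hι (by rw [hw, RingHom.id_apply, map_smul, map_smul, hw]) }
  exact ⟨W.mkContinuous _ hwn, by ext x; exact hw x, W.mkContinuous_norm_le hpos _⟩
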